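/- **Soundness of HOARe².** If a relational typing judgment $G\vdash e_1\sim e_2::T$ is derivable, then for every valuation $\theta$ validating $G$ we have $([\![e_1^{\triangleleft}]\!]_\theta,[\![e_2^{\triangleright}]\!]_\theta)\in(\!|T|\!)_\theta$. The system is the following. **Simple types.** Core types are $\mathbf 1,\mathbb B,\mathbb N,\mathbb R,\overline{\mathbb R}^+=[0,\infty]$ and lists of core types; types are $\tau,\sigma::=$ core types $\mid\mathfrak M[\tau]\mid\mathfrak C[\tau]\mid\tau\to\sigma$. Core types are interpreted as usual, $[\![\mathfrak M[\tau]]\!]$ is the set of discrete probability distributions on $[\![\tau]\!]$, $[\![\mathfrak C[\tau]]\!]=[\![\tau]\!]\cup\{\bot\}$ is the flat cpo, and $[\![\tau\to\sigma]\!]$ is the set of all functions (ordered pointwise if $\sigma=\mathfrak C[\sigma']$). **Expressions** are simply typed and are: variables, constants $n\in\mathbb N$, $\alpha\in\overline{\mathbb R}^+$, $()$, true, false, nil, cons, addition on $\overline{\mathbb R}^+$, application, $\lambda x.e$, let, $\mathsf{letrec}\,f\,x=e$ (of a type $\tau\to\mathfrak C[\sigma]$), $\mathsf{letrec}^{\downarrow}f\,x=e$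 (of any type $\tau\to\sigma$), if, $\mathsf{case}\,e\,[\mathsf{nil}\Rightarrow e_1\mid x::y\Rightarrow e_2]$, and unit and bind of $\mathfrak C$ and of $\mathfrak M$. The denotation is the standard one; $\mathsf{bind}_{\mathfrak C}$ is strict, $\mathsf{unit}_{\mathfrak M}$ is the Dirac distribution, $\mathsf{bind}_{\mathfrak M}$ is $d\mapsto\sum_g[\![e_1]\!](g)\,[\![e_2]\!]_{x\mapsto g}(d)$. Recursive definitions denote $\bigcup_nF^n(\bot)$ with $F(d)=[\![\lambda x.e]\!]_{f\mapsto d}$. For $\mathsf{letrec}$ the value at $v$ is that of the first $F^n(\bot)(v)$ different from $\bot$, if any, and $\bot$ otherwise; if $F$ is monotone this is the least upper bound of the chain $F^n(\bot)$. For $\mathsf{letrec}^{\downarrow}$ the value at $v$ is the $w$ such that for some $n$, $F^n(d)(v)=w$ for all $d$, and a fixed default element if there is none. Call $F$ *terminating* if there is $r:[\![\tau]\!]\to\mathbb N$ such that $F(d)(v)=F(d')(v)$ whenever $d$ and $d'$ agree on all $u$ with $r(u)<r(v)$. **Relational types and assertions.** A relational variable $x$ has a left and a right instance $x^{\triangleleft},x^{\triangleright}$;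 a relational expression is an expression over such instances and plain variables; $e^{\triangleleft}$ and $e^{\triangleright}$ replace every free variable $x$ of $e$ by $x^{\triangleleft}$, resp. $x^{\triangleright}$. Relational types are $T,U::=$ core types $\mid\mathfrak M_{\epsilon,\delta}[T]\mid\mathfrak C[T]\mid\Pi x::T.\,U\mid\{x::T\mid\phi\}$, with $\epsilon,\delta$ relational expressions of type $\overline{\mathbb R}^+$; assertions $\phi,\psi$ are built from $e=e'$ and (at types $\mathbb N,\mathbb R,\overline{\mathbb R}^+$) $e\le e'$ between relational expressions of equal type with $\top,\bot,\neg,\vee,\wedge,\Rightarrow$ and quantifiers over plain variables $x:\tau$ and over relational variables $x::T$. The erasure $\|T\|$ drops refinements and indices. All types and assertions below are well formed: their expressions are simply typed. Assertions are interpreted classically; plain quantifiers range over $[\![\tau]\!]$ and relational ones over the pairs in $(\!|T|\!)_\theta$. $(\!|T|\!)_\theta\subseteq[\![\|T\|]\!]^2$ is: all pairs, for a core type; $\{(d_1,d_2)\in(\!|T|\!)_\theta: [\![\phi]\!]_{\theta[x\mapsto(d_1,d_2)]}\}$ for $\{x::T\mid\phi\}$; the $(f_1,f_2)$ with $(f_1(d_1),f_2(d_2))\in(\!|U|\!)_{\theta[x\mapsto(d_1,d_2)]}$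 for all $(d_1,d_2)\in(\!|T|\!)_\theta$, for $\Pi x::T.\,U$; $(\!|T|\!)_\theta\cup\{(\bot,\bot)\}$ for $\mathfrak C[T]$; the $(\mu_1,\mu_2)$ with $\mathcal L_{\epsilon,\delta}((\!|T|\!)_\theta)\,\mu_1\,\mu_2$ (with $\epsilon,\delta$ evaluated in $\theta$) for $\mathfrak M_{\epsilon,\delta}[T]$. Here $\mathcal L_{\epsilon,\delta}(\Psi)\,\mu_1\,\mu_2$ holds iff there is a sub-distribution $\mu$ on pairs (total mass $\le1$) such that $\mu(a,b)>0$ implies $(a,b)\in\Psi$, $\pi_i\mu\le\mu_i$ and $\Delta_\epsilon(\mu_i,\pi_i\mu)\le\delta$ for $i=1,2$, where $\pi_1\mu,\pi_2\mu$ are the marginals and $\Delta_\epsilon(\mu,\nu)=\sup_E(\mu(E)-e^{\epsilon}\nu(E))$, with $e^\infty=\infty$ and $\infty\cdot0=0$. A relational environment $G$ is a finite sequence of bindings $x::T$ and hypotheses $\{\phi\}$; $\theta\models G$ if $\theta$ assigns to $x^{\triangleleft},x^{\triangleright}$ elements of $[\![\|T\|]\!]$ forming a pair in $(\!|T|\!)_\theta$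 for every binding, and satisfies every hypothesis. **Subtyping** $G\vdash T\preceq U$ is generated by: reflexivity and transitivity; congruence for lists and for $\mathfrak C$; $\{x::T\mid\phi\}\preceq T$; $T\preceq\{x::U\mid\phi\}$ if $T\preceq U$ and every $\theta\models G,x::T$ satisfies $\phi$; $\mathfrak M_{\epsilon_1,\delta_1}[T]\preceq\mathfrak M_{\epsilon_2,\delta_2}[U]$ if $T\preceq U$ and $\epsilon_1\le\epsilon_2<\infty$, $\delta_1\le\delta_2<\infty$ in every $\theta\models G$; $\Pi x::T_1.U_1\preceq\Pi x::T_2.U_2$ if $G\vdash T_2\preceq T_1$ and $G,x::T_2\vdash U_1\preceq U_2$. **Reduction** $e\to e'$ is one step, anywhere in the expression, of $\beta$, let, if, case, $\mathsf{bind}(\mathsf{unit}\,e_1)$ for both monads, addition of constants, or unfolding of an applied recursive function, where $\mathsf{letrec}$ unfolds if its functional $F$ is $\omega$-continuous, and $\mathsf{letrec}^{\downarrow}$ if its $F$ is terminating, in all valuations. **Typing.** Derivability is given by the rules below ($G\vdash e::T$ abbreviates $G\vdash e\sim e::T$; for readability the rules of the first group are written for one expression, but all of them are available for two expressions $e\sim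 e'$ of the same shape, with left instances taken from $e$ and right instances from $e'$). - $G\vdash x::xG$; constants have their core type; cons and $+$ applied to arguments of the right core types have theirs. - $G,x::T\vdash e::U$ gives $G\vdash\lambda x.e::\Pi x::T.U$. From $G\vdash e_1::\Pi x::T.U$ and $G\vdash e_2::T$, $G\vdash e_1\,e_2::U\{x\mapsto e_2\}$, where the substitution puts $e_2^{\triangleleft},e_2^{\triangleright}$ for $x^{\triangleleft},x^{\triangleright}$. From $G\vdash e_1::T$ and $G,x::T\vdash e_2::U$, $G\vdash\mathsf{let}\,x=e_1\,\mathsf{in}\,e_2::U\{x\mapsto e_1\}$. - $G,f::\Pi x::T.\mathfrak C[U]\vdash\lambda x.e::\Pi x::T.\mathfrak C[U]$ gives $G\vdash\mathsf{letrec}\,f\,x=e::\Pi x::T.\mathfrak C[U]$. $G,f::\Pi x::T.U\vdash\lambda x.e::\Pi x::T.U$ gives $G\vdash\mathsf{letrec}^{\downarrow}f\,x=e::\Pi x::T.U$ under the guard: for every $\theta\models G$ the left and right functionals $F$ are terminating and $(\!|\Pi x::T.U|\!)_\theta\ne\emptyset$. - Case: if $G\vdash e::\mathsf{list}\,c$,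 every $\theta\models G$ satisfies $e^{\triangleleft}=\mathsf{nil}\Leftrightarrow e^{\triangleright}=\mathsf{nil}$, $G\vdash e_1::T$, and $G,x::c,y::\mathsf{list}\,c,\{e^{\triangleleft}=x^{\triangleleft}::y^{\triangleleft}\wedge e^{\triangleright}=x^{\triangleright}::y^{\triangleright}\}\vdash e_2::T$, then the case expression has type $T$. If: likewise for booleans, each branch being typed under the hypothesis that both guards are true, resp. both false. - $G\vdash e::T$ gives $G\vdash\mathsf{unit}_{\mathfrak C}e::\mathfrak C[T]$ and $G\vdash\mathsf{unit}_{\mathfrak M}e::\mathfrak M_{\epsilon,\delta}[T]$ for all $\epsilon,\delta$. $G\vdash e_1::\mathfrak C[T_1]$ and $G,x::T_1\vdash e_2::\mathfrak C[T_2]$ give $G\vdash\mathsf{bind}_{\mathfrak C}\,x=e_1\,\mathsf{in}\,e_2::\mathfrak C[T_2]$. $G\vdash e_1::\mathfrak M_{\epsilon_1,\delta_1}[T_1]$ and $G,x::T_1\vdash e_2::\mathfrak M_{\epsilon_2,\delta_2}[T_2]$ give $G\vdash\mathsf{bind}_{\mathfrak M}\,x=e_1\,\mathsf{in}\,e_2::\mathfrak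 M_{\epsilon_1+\epsilon_2,\delta_1+\delta_2}[T_2]$ (in both, $x$ is not free in $T_2$, nor in $\epsilon_2,\delta_2$). Second group (two arbitrary expressions): - $G\vdash e\sim e'::T$ and $G\vdash T\preceq U$ give $G\vdash e\sim e'::U$. - If $G\vdash e_1\sim e_2::T$ and $e_1\to e_1'$, then $G\vdash e_1'\sim e_2::T$; symmetrically on the right. - For $e$ of type $\mathsf{list}\,c$: if $G,\{e^{\triangleleft}=\mathsf{nil}\}\vdash e_1\sim e'::T$ and $G,x::c,y::\mathsf{list}\,c,\{e^{\triangleleft}=x^{\triangleleft}::y^{\triangleleft}\}\vdash e_2\sim e'::T$, then $G\vdash\mathsf{case}\,e\,[\mathsf{nil}\Rightarrow e_1\mid x::y\Rightarrow e_2]\sim e'::T$; likewise for if; symmetrically on the right. -/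

import Mathlib

namespace HOARe

/-! ### Simple types and their interpretation -/

/-- Core types. -/
inductive CoreTy : Type
  | unit
  | bool
  | nat
  | real
  /-- the extended non-negative reals `[0, ∞]` -/
  | xreal
  | list (c : CoreTy)

/-- Simple types: core types, the probability monad, the partiality monad, functions. -/
inductive Ty : Type
  | core (c : CoreTy)
  | prob (τ : Ty)
  | part (τ : Ty)
  | fn (τ σ : Ty)

@[reducible] def CoreTy.den : CoreTy → Type
  | .unit => Unit
  | .bool => Bool
  | .nat => ℕ
  | .real => ℝ
  | .xreal => ENNReal
  | .list c => List c.den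

/-- Discrete distributions are Mathlib's `PMF` (functions `α → [0, ∞]` of total mass one, whose
support is automatically countable); `Part α` is the flat cpo `α ∪ {⊥}`. Function types are full
function spaces; into a type `part σ` they form a cpo under the pointwise order. -/
@[reducible] def Ty.den : Ty → Type
  | .core c => c.den
  | .prob τ => PMF τ.den
  | .part τ => Part τ.den
  | .fn τ σ => τ.den → σ.den

def CoreTy.default : (c : CoreTy) → c.den
  | .unit => ()
  | .bool => false
  | .nat => (0 : ℕ)
  | .real => (0 : ℝ)
  | .xreal => (0 : ENNReal)
  | .list _ => []

/-- Every simple type is inhabited. -/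
noncomputable def Ty.default : (τ : Ty) → τ.den
  | .core c => c.default
  | .prob τ => PMF.pure τ.default
  | .part _ => Part.none
  | .fn _ σ => fun _ => σ.default

/-- The numeric core types, those on which `≤` is an assertion. -/
inductive NumTy : Type
  | nat
  | real
  | xreal

@[reducible] def NumTy.toTy : NumTy → Ty
  | .nat => .core .nat
  | .real => .core .real
  | .xreal => .core .xreal

def NumTy.le : (n : NumTy) → n.toTy.den → n.toTy.den → Prop
  | .nat => fun (a b : ℕ) => a ≤ b
  | .real => fun (a b : ℝ) => a ≤ b
  | .xreal => fun (a b : ENNReal) => a ≤ b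

/-! ### Expressions (intrinsically typed, de Bruijn indices) -/

/-- Typed variables of a simple context; the most recently bound variable is the head. -/
inductive Var : List Ty → Ty → Type
  | z {Γ : List Ty} {τ : Ty} : Var (τ :: Γ) τ
  | s {Γ : List Ty} {τ σ : Ty} (x : Var Γ τ) : Var (σ :: Γ) τ

/-- `Tm Γ τ` is the set of expressions `e` with `Γ ⊢ e : τ`. -/
inductive Tm : List Ty → Ty → Type
  | var {Γ : List Ty} {τ : Ty} (x : Var Γ τ) : Tm Γ τ
  | natLit {Γ : List Ty} (n : ℕ) : Tm Γ (.core .nat)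
  | xrealLit {Γ : List Ty} (a : ENNReal) : Tm Γ (.core .xreal)
  | unit {Γ : List Ty} : Tm Γ (.core .unit)
  | ff {Γ : List Ty} : Tm Γ (.core .bool)
  | tt {Γ : List Ty} : Tm Γ (.core .bool)
  | nil {Γ : List Ty} {c : CoreTy} : Tm Γ (.core (.list c))
  | cons {Γ : List Ty} {c : CoreTy} (e₁ : Tm Γ (.core c)) (e₂ : Tm Γ (.core (.list c))) :
      Tm Γ (.core (.list c))
  /-- addition on `[0, ∞]`, used in the indices `ε₁ + ε₂`, `δ₁ + δ₂` -/
  | add {Γ : List Ty} (e₁ e₂ : Tm Γ (.core .xreal)) : Tm Γ (.core .xreal)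
  | app {Γ : List Ty} {τ σ : Ty} (e₁ : Tm Γ (.fn τ σ)) (e₂ : Tm Γ τ) : Tm Γ σ
  | lam {Γ : List Ty} {τ σ : Ty} (e : Tm (τ :: Γ) σ) : Tm Γ (.fn τ σ)
  /-- `let x = e₁ in e₂` -/
  | letin {Γ : List Ty} {τ σ : Ty} (e₁ : Tm Γ τ) (e₂ : Tm (τ :: Γ) σ) : Tm Γ σ
  /-- unrestricted recursion `letrec f x = e`, with result in the partiality monad -/
  | letrec {Γ : List Ty} {τ σ : Ty} (e : Tm (τ :: .fn τ (.part σ) :: Γ) (.part σ)) :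
      Tm Γ (.fn τ (.part σ))
  /-- terminating recursion `letrec↓ f x = e` -/
  | letrecSN {Γ : List Ty} {τ σ : Ty} (e : Tm (τ :: .fn τ σ :: Γ) σ) : Tm Γ (.fn τ σ)
  | ite {Γ : List Ty} {τ : Ty} (e : Tm Γ (.core .bool)) (e₁ e₂ : Tm Γ τ) : Tm Γ τ
  /-- `case e of [nil ⇒ e₁ | x :: y ⇒ e₂]`; in `e₂` the variable `y` has index 0, `x` index 1 -/
  | case {Γ : List Ty} {c : CoreTy} {τ : Ty} (e : Tm Γ (.core (.list c))) (e₁ : Tm Γ τ)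
      (e₂ : Tm (.core (.list c) :: .core c :: Γ) τ) : Tm Γ τ
  | unitC {Γ : List Ty} {τ : Ty} (e : Tm Γ τ) : Tm Γ (.part τ)
  | bindC {Γ : List Ty} {τ σ : Ty} (e₁ : Tm Γ (.part τ)) (e₂ : Tm (τ :: Γ) (.part σ)) :
      Tm Γ (.part σ)
  | unitM {Γ : List Ty} {τ : Ty} (e : Tm Γ τ) : Tm Γ (.prob τ)
  | bindM {Γ : List Ty} {τ σ : Ty} (e₁ : Tm Γ (.prob τ)) (e₂ : Tm (τ :: Γ) (.prob σ)) :
      Tm Γ (.prob σ)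

/-! Renaming and simultaneous substitution. -/

abbrev Ren (Γ Γ' : List Ty) : Type := ∀ τ : Ty, Var Γ τ → Var Γ' τ

abbrev Sb (Γ Γ' : List Ty) : Type := ∀ τ : Ty, Var Γ τ → Tm Γ' τ

def Ren.lift {Γ Γ' : List Ty} (ρ : Ren Γ Γ') {σ : Ty} : Ren (σ :: Γ) (σ :: Γ')
  | _, .z => .z
  | _, .s x => .s (ρ _ x)

def Tm.ren {Γ : List Ty} {τ : Ty} : Tm Γ τ → {Γ' : List Ty} → Ren Γ Γ' → Tm Γ' τ
  | .var x, _, ρ => .var (ρ _ x)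
  | .natLit n, _, _ => .natLit n
  | .xrealLit a, _, _ => .xrealLit a
  | .unit, _, _ => .unit
  | .ff, _, _ => .ff
  | .tt, _, _ => .tt
  | .nil, _, _ => .nil
  | .cons e₁ e₂, _, ρ => .cons (e₁.ren ρ) (e₂.ren ρ)
  | .add e₁ e₂, _, ρ => .add (e₁.ren ρ) (e₂.ren ρ)
  | .app e₁ e₂, _, ρ => .app (e₁.ren ρ) (e₂.ren ρ)
  | .lam e, _, ρ => .lam (e.ren ρ.lift)
  | .letin e₁ e₂, _, ρ => .letin (e₁.ren ρ) (e₂.ren ρ.lift)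
  | .letrec e, _, ρ => .letrec (e.ren ρ.lift.lift)
  | .letrecSN e, _, ρ => .letrecSN (e.ren ρ.lift.lift)
  | .ite e e₁ e₂, _, ρ => .ite (e.ren ρ) (e₁.ren ρ) (e₂.ren ρ)
  | .case e e₁ e₂, _, ρ => .case (e.ren ρ) (e₁.ren ρ) (e₂.ren ρ.lift.lift)
  | .unitC e, _, ρ => .unitC (e.ren ρ)
  | .bindC e₁ e₂, _, ρ => .bindC (e₁.ren ρ) (e₂.ren ρ.lift)
  | .unitM e, _, ρ => .unitM (e.ren ρ)
  | .bindM e₁ e₂, _, ρ => .bindM (e₁.ren ρ) (e₂.ren ρ.lift)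

def Ren.wk {Γ : List Ty} {σ : Ty} : Ren Γ (σ :: Γ) := fun _ x => .s x

def Ren.wk2 {Γ : List Ty} {σ σ' : Ty} : Ren Γ (σ :: σ' :: Γ) := fun _ x => .s (.s x)

def Ren.wk4 {Γ : List Ty} {σ₁ σ₂ σ₃ σ₄ : Ty} : Ren Γ (σ₁ :: σ₂ :: σ₃ :: σ₄ :: Γ) :=
  fun _ x => .s (.s (.s (.s x)))

def Sb.lift {Γ Γ' : List Ty} (ξ : Sb Γ Γ') {σ : Ty} : Sb (σ :: Γ) (σ :: Γ')
  | _, .z => .var .z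
  | _, .s x => (ξ _ x).ren Ren.wk

def Tm.subst {Γ : List Ty} {τ : Ty} : Tm Γ τ → {Γ' : List Ty} → Sb Γ Γ' → Tm Γ' τ
  | .var x, _, ξ => ξ _ x
  | .natLit n, _, _ => .natLit n
  | .xrealLit a, _, _ => .xrealLit a
  | .unit, _, _ => .unit
  | .ff, _, _ => .ff
  | .tt, _, _ => .tt
  | .nil, _, _ => .nil
  | .cons e₁ e₂, _, ξ => .cons (e₁.subst ξ) (e₂.subst ξ)
  | .add e₁ e₂, _, ξ => .add (e₁.subst ξ) (e₂.subst ξ)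
  | .app e₁ e₂, _, ξ => .app (e₁.subst ξ) (e₂.subst ξ)
  | .lam e, _, ξ => .lam (e.subst ξ.lift)
  | .letin e₁ e₂, _, ξ => .letin (e₁.subst ξ) (e₂.subst ξ.lift)
  | .letrec e, _, ξ => .letrec (e.subst ξ.lift.lift)
  | .letrecSN e, _, ξ => .letrecSN (e.subst ξ.lift.lift)
  | .ite e e₁ e₂, _, ξ => .ite (e.subst ξ) (e₁.subst ξ) (e₂.subst ξ)
  | .case e e₁ e₂, _, ξ => .case (e.subst ξ) (e₁.subst ξ) (e₂.subst ξ.lift.lift)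
  | .unitC e, _, ξ => .unitC (e.subst ξ)
  | .bindC e₁ e₂, _, ξ => .bindC (e₁.subst ξ) (e₂.subst ξ.lift)
  | .unitM e, _, ξ => .unitM (e.subst ξ)
  | .bindM e₁ e₂, _, ξ => .bindM (e₁.subst ξ) (e₂.subst ξ.lift)

/-- `{x ↦ e}` for the variable of index 0. -/
def Sb.one {Γ : List Ty} {σ : Ty} (e : Tm Γ σ) : Sb (σ :: Γ) Γ
  | _, .z => e
  | _, .s x => .var x

/-- `{x₀ ↦ e₀, x₁ ↦ e₁}` for the variables `x₀`, `x₁` of index 0 and 1. -/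
def Sb.two {Γ : List Ty} {σ₀ σ₁ : Ty} (e₀ : Tm Γ σ₀) (e₁ : Tm Γ σ₁) : Sb (σ₀ :: σ₁ :: Γ) Γ
  | _, .z => e₀
  | _, .s .z => e₁
  | _, .s (.s x) => .var x

/-! ### Denotation of expressions -/

/-- Valuations of a simple context. -/
abbrev Env (Γ : List Ty) : Type := ∀ τ : Ty, Var Γ τ → τ.den

def Env.cons {Γ : List Ty} {σ : Ty} (d : σ.den) (θ : Env Γ) : Env (σ :: Γ)
  | _, .z => d
  | _, .s x => θ _ x

def Env.tail {Γ : List Ty} {σ : Ty} (θ : Env (σ :: Γ)) : Env Γ := fun _ x => θ _ (.s x)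

open Classical in
/-- The union `⋃ₙ Fⁿ(⊥)` of the iterates of `F` on partial functions `α ⇀ β`: at `a`, the value of
the first iterate that is defined at `a`, and `⊥` if none is. For monotone `F` the iterates form a
chain and this is their least upper bound, see `mem_kleene_iff`. -/
noncomputable def kleene {α β : Type} (F : (α → Part β) → α → Part β) : α → Part β := fun a =>
  if h : ∃ n : ℕ, ((F^[n] ⊥) a).Dom then (F^[Nat.find h] ⊥) a else Part.none

theorem mem_kleene_iff {α β : Type} {F : (α → Part β) → α → Part β} (hF : Monotone F) (a : α)
    (b : β) : b ∈ kleene F a ↔ ∃ n : ℕ, b ∈ (F^[n] ⊥) a := by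
  classical
  have hmono : Monotone fun n : ℕ => F^[n] ⊥ := hF.monotone_iterate_of_le_map bot_le
  unfold kleene
  split_ifs with h
  · refine ⟨fun hb => ⟨_, hb⟩, fun ⟨n, hn⟩ => ?_⟩
    have hle : Nat.find h ≤ n := Nat.find_min' h (Part.dom_iff_mem.2 ⟨b, hn⟩)
    obtain ⟨b', hb'⟩ := Part.dom_iff_mem.1 (Nat.find_spec h)
    have : b' = b := Part.mem_unique (hmono hle a b' hb') hn
    exact this ▸ hb'
  · refine ⟨fun hb => absurd hb (Part.notMem_none b), fun ⟨n, hn⟩ => ?_⟩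
    exact absurd ⟨n, Part.dom_iff_mem.2 ⟨b, hn⟩⟩ h

open Classical in
/-- The union `⋃ₙ Fⁿ(⊥)` for a functional on total functions, `⊥` being nowhere defined: `Fⁿ(⊥)` is
defined at `a` with value `b` when `Fⁿ(d)(a) = b` whatever `d` is. Where no iterate is defined
(excluded by the termination guard), the value is the irrelevant element `b₀`. -/
noncomputable def kleeneSN {α β : Type} (b₀ : β) (F : (α → β) → α → β) : α → β := fun a =>
  if h : ∃ b : β, ∃ n : ℕ, ∀ d : α → β, (F^[n] d) a = b then h.choose else b₀

/-- The termination guard: for some size `r` on arguments, `F d` at `a` only calls `d` at arguments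
of size smaller than that of `a`. -/
def Terminating {α β : Type} (F : (α → β) → α → β) : Prop :=
  ∃ r : α → ℕ, ∀ (a : α) (d d' : α → β), (∀ b, r b < r a → d b = d' b) → F d a = F d' a

noncomputable def Tm.den {Γ : List Ty} {τ : Ty} : Tm Γ τ → Env Γ → τ.den
  | .var x, θ => θ _ x
  | .natLit n, _ => n
  | .xrealLit a, _ => a
  | .unit, _ => ()
  | .ff, _ => false
  | .tt, _ => true
  | .nil, _ => []
  | .cons e₁ e₂, θ => List.cons (e₁.den θ) (e₂.den θ)
  | .add e₁ e₂, θ => ((e₁.den θ : ENNReal) + (e₂.den θ : ENNReal) : ENNReal)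
  | .app e₁ e₂, θ => (e₁.den θ) (e₂.den θ)
  | .lam e, θ => fun v => e.den (θ.cons v)
  | .letin e₁ e₂, θ => e₂.den (θ.cons (e₁.den θ))
  | .letrec e, θ => kleene fun d v => e.den ((θ.cons d).cons v)
  | @Tm.letrecSN _ _ σ e, θ => kleeneSN σ.default fun d v => e.den ((θ.cons d).cons v)
  | .ite e e₁ e₂, θ => bif (e.den θ : Bool) then e₁.den θ else e₂.den θ
  | .case e e₁ e₂, θ =>
      match e.den θ with
      | [] => e₁.den θ
      | v :: vs => e₂.den ((θ.cons v).cons vs)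
  | .unitC e, θ => Part.some (e.den θ)
  | .bindC e₁ e₂, θ => Part.bind (e₁.den θ) fun v => e₂.den (θ.cons v)
  | .unitM e, θ => PMF.pure (e.den θ)
  | .bindM e₁ e₂, θ => PMF.bind (e₁.den θ) fun v => e₂.den (θ.cons v)

/-- The functional `F(d) = ⟦λ x. e⟧` (with `f ↦ d`) of a recursive definition of `f x` as `e`. -/
noncomputable def Tm.functional {Γ : List Ty} {τ σ : Ty} (e : Tm (τ :: .fn τ σ :: Γ) σ)
    (θ : Env Γ) : (τ.den → σ.den) → τ.den → σ.den :=
  fun d v => e.den ((θ.cons (σ := .fn τ σ) d).cons v)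

/-! ### Relational types and assertions

A relational variable `x` of erased type `τ` is a pair of adjacent variables `x◁, x▷` of type `τ` in
a simple context (`x◁` has index 0 just after binding, `x▷` index 1), a plain variable is one
variable; so the context `Γ` of a relational type, an assertion or a relational expression is a
simple context. Relational types are indexed by their erasure. -/

mutual

inductive RTy : List Ty → Ty → Type
  | core {Γ : List Ty} (c : CoreTy) : RTy Γ (.core c)
  /-- the polymonad `M_{ε,δ}[T]` -/
  | prob {Γ : List Ty} {τ : Ty} (ε δ : Tm Γ (.core .xreal)) (T : RTy Γ τ) : RTy Γ (.prob τ)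
  /-- the partiality monad `C[T]` -/
  | part {Γ : List Ty} {τ : Ty} (T : RTy Γ τ) : RTy Γ (.part τ)
  /-- the dependent product `Π x :: T. U` -/
  | pi {Γ : List Ty} {τ σ : Ty} (T : RTy Γ τ) (U : RTy (τ :: τ :: Γ) σ) : RTy Γ (.fn τ σ)
  /-- the refinement `{x :: T | φ}` -/
  | ref {Γ : List Ty} {τ : Ty} (T : RTy Γ τ) (φ : Assn (τ :: τ :: Γ)) : RTy Γ τ

inductive Assn : List Ty → Type
  /-- quantifiers over a plain variable -/
  | allP {Γ : List Ty} (τ : Ty) (φ : Assn (τ :: Γ)) : Assn Γ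
  | exP {Γ : List Ty} (τ : Ty) (φ : Assn (τ :: Γ)) : Assn Γ
  /-- quantifiers over a relational variable -/
  | allR {Γ : List Ty} {τ : Ty} (T : RTy Γ τ) (φ : Assn (τ :: τ :: Γ)) : Assn Γ
  | exR {Γ : List Ty} {τ : Ty} (T : RTy Γ τ) (φ : Assn (τ :: τ :: Γ)) : Assn Γ
  | top {Γ : List Ty} : Assn Γ
  | bot {Γ : List Ty} : Assn Γ
  | not {Γ : List Ty} (φ : Assn Γ) : Assn Γ
  | or {Γ : List Ty} (φ ψ : Assn Γ) : Assn Γ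
  | and {Γ : List Ty} (φ ψ : Assn Γ) : Assn Γ
  | imp {Γ : List Ty} (φ ψ : Assn Γ) : Assn Γ
  | eq {Γ : List Ty} {τ : Ty} (e₁ e₂ : Tm Γ τ) : Assn Γ
  | le {Γ : List Ty} (n : NumTy) (e₁ e₂ : Tm Γ n.toTy) : Assn Γ

end

mutual

def RTy.ren {Γ : List Ty} {τ : Ty} : RTy Γ τ → {Γ' : List Ty} → Ren Γ Γ' → RTy Γ' τ
  | .core c, _, _ => .core c
  | .prob ε δ T, _, ρ => .prob (ε.ren ρ) (δ.ren ρ) (T.ren ρ)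
  | .part T, _, ρ => .part (T.ren ρ)
  | .pi T U, _, ρ => .pi (T.ren ρ) (U.ren ρ.lift.lift)
  | .ref T φ, _, ρ => .ref (T.ren ρ) (φ.ren ρ.lift.lift)

def Assn.ren {Γ : List Ty} : Assn Γ → {Γ' : List Ty} → Ren Γ Γ' → Assn Γ'
  | .allP τ φ, _, ρ => .allP τ (φ.ren ρ.lift)
  | .exP τ φ, _, ρ => .exP τ (φ.ren ρ.lift)
  | .allR T φ, _, ρ => .allR (T.ren ρ) (φ.ren ρ.lift.lift)
  | .exR T φ, _, ρ => .exR (T.ren ρ) (φ.ren ρ.lift.lift)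
  | .top, _, _ => .top
  | .bot, _, _ => .bot
  | .not φ, _, ρ => .not (φ.ren ρ)
  | .or φ ψ, _, ρ => .or (φ.ren ρ) (ψ.ren ρ)
  | .and φ ψ, _, ρ => .and (φ.ren ρ) (ψ.ren ρ)
  | .imp φ ψ, _, ρ => .imp (φ.ren ρ) (ψ.ren ρ)
  | .eq e₁ e₂, _, ρ => .eq (e₁.ren ρ) (e₂.ren ρ)
  | .le n e₁ e₂, _, ρ => .le n (e₁.ren ρ) (e₂.ren ρ)

end

mutual

def RTy.subst {Γ : List Ty} {τ : Ty} : RTy Γ τ → {Γ' : List Ty} → Sb Γ Γ' → RTy Γ' τ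
  | .core c, _, _ => .core c
  | .prob ε δ T, _, ξ => .prob (ε.subst ξ) (δ.subst ξ) (T.subst ξ)
  | .part T, _, ξ => .part (T.subst ξ)
  | .pi T U, _, ξ => .pi (T.subst ξ) (U.subst ξ.lift.lift)
  | .ref T φ, _, ξ => .ref (T.subst ξ) (φ.subst ξ.lift.lift)

def Assn.subst {Γ : List Ty} : Assn Γ → {Γ' : List Ty} → Sb Γ Γ' → Assn Γ'
  | .allP τ φ, _, ξ => .allP τ (φ.subst ξ.lift)
  | .exP τ φ, _, ξ => .exP τ (φ.subst ξ.lift)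
  | .allR T φ, _, ξ => .allR (T.subst ξ) (φ.subst ξ.lift.lift)
  | .exR T φ, _, ξ => .exR (T.subst ξ) (φ.subst ξ.lift.lift)
  | .top, _, _ => .top
  | .bot, _, _ => .bot
  | .not φ, _, ξ => .not (φ.subst ξ)
  | .or φ ψ, _, ξ => .or (φ.subst ξ) (ψ.subst ξ)
  | .and φ ψ, _, ξ => .and (φ.subst ξ) (ψ.subst ξ)
  | .imp φ ψ, _, ξ => .imp (φ.subst ξ) (ψ.subst ξ)
  | .eq e₁ e₂, _, ξ => .eq (e₁.subst ξ) (e₂.subst ξ)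
  | .le n e₁ e₂, _, ξ => .le n (e₁.subst ξ) (e₂.subst ξ)

end

/-! ### The (ε, δ)-lifting -/

/-- The `ε`-distance `Δ_ε(μ, ν) = sup_E (μ(E) - exp(ε) ν(E))` of two discrete (sub-)distributions.
Truncated subtraction does not change the supremum, because `E = ∅` contributes `0`. -/
noncomputable def epsDist {α : Type} (ε : ENNReal) (μ ν : α → ENNReal) : ENNReal :=
  ⨆ E : Set α, (∑' a, E.indicator μ a) - EReal.exp (ε : EReal) * ∑' a, E.indicator ν a

noncomputable def marginalFst {α β : Type} (μ : α × β → ENNReal) : α → ENNReal :=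
  fun a => ∑' b, μ (a, b)

noncomputable def marginalSnd {α β : Type} (μ : α × β → ENNReal) : β → ENNReal :=
  fun b => ∑' a, μ (a, b)

/-- The lifting of a relation `Ψ` to distributions; the witness `μ` is a sub-distribution. -/
def Lifting {α β : Type} (ε δ : ENNReal) (Ψ : Set (α × β)) (μ₁ : PMF α) (μ₂ : PMF β) : Prop :=
  ∃ μ : α × β → ENNReal,
    ∑' p, μ p ≤ 1 ∧
    (∀ p, 0 < μ p → p ∈ Ψ) ∧
    ((∀ a, marginalFst μ a ≤ μ₁ a) ∧ ∀ b, marginalSnd μ b ≤ μ₂ b) ∧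
    epsDist ε μ₁ (marginalFst μ) ≤ δ ∧ epsDist ε μ₂ (marginalSnd μ) ≤ δ

/-! ### Interpretation of relational types and assertions -/

mutual

def RTy.den {Γ : List Ty} {τ : Ty} : RTy Γ τ → Env Γ → Set (τ.den × τ.den)
  | .core _, _ => Set.univ
  | .prob ε δ T, θ => {p | Lifting (ε.den θ) (δ.den θ) (T.den θ) p.1 p.2}
  | .part T, θ => {p | (p.1 = Part.none ∧ p.2 = Part.none) ∨
      ∃ d₁ d₂, p.1 = Part.some d₁ ∧ p.2 = Part.some d₂ ∧ (d₁, d₂) ∈ T.den θ}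
  | .pi T U, θ => {f | ∀ d₁ d₂, (d₁, d₂) ∈ T.den θ →
      (f.1 d₁, f.2 d₂) ∈ U.den ((θ.cons d₂).cons d₁)}
  | .ref T φ, θ => {p | p ∈ T.den θ ∧ φ.den ((θ.cons p.2).cons p.1)}

def Assn.den {Γ : List Ty} : Assn Γ → Env Γ → Prop
  | .allP τ φ, θ => ∀ d : τ.den, φ.den (θ.cons d)
  | .exP τ φ, θ => ∃ d : τ.den, φ.den (θ.cons d)
  | .allR T φ, θ => ∀ d₁ d₂, (d₁, d₂) ∈ T.den θ → φ.den ((θ.cons d₂).cons d₁)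
  | .exR T φ, θ => ∃ d₁ d₂, (d₁, d₂) ∈ T.den θ ∧ φ.den ((θ.cons d₂).cons d₁)
  | .top, _ => True
  | .bot, _ => False
  | .not φ, θ => ¬ φ.den θ
  | .or φ ψ, θ => φ.den θ ∨ ψ.den θ
  | .and φ ψ, θ => φ.den θ ∧ ψ.den θ
  | .imp φ ψ, θ => φ.den θ → ψ.den θ
  | .eq e₁ e₂, θ => e₁.den θ = e₂.den θ
  | .le n e₁ e₂, θ => n.le (e₁.den θ) (e₂.den θ)

end

/-! ### Relational environments -/

/-- The simple context `x◁ : τ, x▷ : τ` for `x : τ` in `Δ`. -/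
@[reducible] def dbl : List Ty → List Ty
  | [] => []
  | τ :: Δ => τ :: τ :: dbl Δ

/-- `x ↦ x◁` -/
def leftVar : {Δ : List Ty} → Ren Δ (dbl Δ)
  | _ :: _, _, .z => .z
  | _ :: _, _, .s x => .s (.s (leftVar _ x))

/-- `x ↦ x▷` -/
def rightVar : {Δ : List Ty} → Ren Δ (dbl Δ)
  | _ :: _, _, .z => .s .z
  | _ :: _, _, .s x => .s (.s (rightVar _ x))

/-- `e◁`: every free variable `x` of `e` is replaced by `x◁`. -/
def Tm.left {Δ : List Ty} {τ : Ty} (e : Tm Δ τ) : Tm (dbl Δ) τ := e.ren leftVar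

/-- `e▷`: every free variable `x` of `e` is replaced by `x▷`. -/
def Tm.right {Δ : List Ty} {τ : Ty} (e : Tm Δ τ) : Tm (dbl Δ) τ := e.ren rightVar

/-- Relational environments, indexed by their erasure: bindings `x :: T` and hypotheses `{φ}`. -/
inductive REnv : List Ty → Type
  | nil : REnv []
  | bind {Δ : List Ty} {τ : Ty} (G : REnv Δ) (T : RTy (dbl Δ) τ) : REnv (τ :: Δ)
  | hyp {Δ : List Ty} (G : REnv Δ) (φ : Assn (dbl Δ)) : REnv Δ

/-- The type `xG` of a variable, as a type over all of `G`. -/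
def REnv.lookup : {Δ : List Ty} → REnv Δ → {τ : Ty} → Var Δ τ → RTy (dbl Δ) τ
  | _, .bind _ T, _, .z => T.ren Ren.wk2
  | _, .bind G _, _, .s x => (G.lookup x).ren Ren.wk2
  | _, .hyp G _, _, x => G.lookup x

/-- `θ` validates the relational environment. -/
def REnv.Valid : {Δ : List Ty} → REnv Δ → Env (dbl Δ) → Prop
  | _, .nil, _ => True
  | _, .bind G T, θ => G.Valid θ.tail.tail ∧ (θ _ .z, θ _ (.s .z)) ∈ T.den θ.tail.tail
  | _, .hyp G φ, θ => G.Valid θ ∧ φ.den θ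

/-! ### Subtyping -/

inductive Subty : {Δ : List Ty} → {τ : Ty} → REnv Δ → RTy (dbl Δ) τ → RTy (dbl Δ) τ → Prop
  | refl {Δ : List Ty} {τ : Ty} (G : REnv Δ) (T : RTy (dbl Δ) τ) : Subty G T T
  | trans {Δ : List Ty} {τ : Ty} {G : REnv Δ} {T U V : RTy (dbl Δ) τ} :
      Subty G T U → Subty G U V → Subty G T V
  | list {Δ : List Ty} {G : REnv Δ} {c : CoreTy} :
      Subty G (.core c) (.core c) → Subty G (.core (.list c)) (.core (.list c))
  | part {Δ : List Ty} {τ : Ty} {G : REnv Δ} {T U : RTy (dbl Δ) τ} :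
      Subty G T U → Subty G (.part T) (.part U)
  | left {Δ : List Ty} {τ : Ty} (G : REnv Δ) (T : RTy (dbl Δ) τ)
      (φ : Assn (dbl (τ :: Δ))) : Subty G (.ref T φ) T
  | right {Δ : List Ty} {τ : Ty} {G : REnv Δ} {T U : RTy (dbl Δ) τ}
      (φ : Assn (dbl (τ :: Δ))) :
      Subty G T U → (∀ θ, (G.bind T).Valid θ → φ.den θ) → Subty G T (.ref U φ)
  | prob {Δ : List Ty} {τ : Ty} {G : REnv Δ} {T U : RTy (dbl Δ) τ}
      {ε₁ ε₂ δ₁ δ₂ : Tm (dbl Δ) (.core .xreal)} :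
      Subty G T U →
      (∀ θ, G.Valid θ →
        ((ε₁.den θ : ENNReal) ≤ ε₂.den θ ∧ (ε₂.den θ : ENNReal) < ⊤) ∧
        ((δ₁.den θ : ENNReal) ≤ δ₂.den θ ∧ (δ₂.den θ : ENNReal) < ⊤)) →
      Subty G (.prob ε₁ δ₁ T) (.prob ε₂ δ₂ U)
  | pi {Δ : List Ty} {τ σ : Ty} {G : REnv Δ} {T₁ T₂ : RTy (dbl Δ) τ}
      {U₁ U₂ : RTy (dbl (τ :: Δ)) σ} :
      Subty G T₂ T₁ → Subty (G.bind T₂) U₁ U₂ → Subty G (.pi T₁ U₁) (.pi T₂ U₂)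

/-! ### Reduction -/

/-- One step of reduction of expressions, in an arbitrary context. A terminating recursion unfolds
when it passes the termination guard, an unrestricted one when its functional is continuous. -/
inductive Red : {Γ : List Ty} → {τ : Ty} → Tm Γ τ → Tm Γ τ → Prop
  | beta {Γ : List Ty} {τ σ : Ty} (e : Tm (τ :: Γ) σ) (e' : Tm Γ τ) :
      Red (.app (.lam e) e') (e.subst (Sb.one e'))
  | letin {Γ : List Ty} {τ σ : Ty} (e₁ : Tm Γ τ) (e₂ : Tm (τ :: Γ) σ) :
      Red (.letin e₁ e₂) (e₂.subst (Sb.one e₁))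
  | letrec {Γ : List Ty} {τ σ : Ty} (e : Tm (τ :: .fn τ (.part σ) :: Γ) (.part σ)) (e' : Tm Γ τ) :
      (∀ θ : Env Γ, OmegaCompletePartialOrder.ωScottContinuous
        (α := τ.den → Part σ.den) (β := τ.den → Part σ.den) (e.functional θ)) →
      Red (.app (.letrec e) e') (e.subst (Sb.two e' (.letrec e)))
  | letrecSN {Γ : List Ty} {τ σ : Ty} (e : Tm (τ :: .fn τ σ :: Γ) σ) (e' : Tm Γ τ) :
      (∀ θ : Env Γ, Terminating (e.functional θ)) →
      Red (.app (.letrecSN e) e') (e.subst (Sb.two e' (.letrecSN e)))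
  | iteTrue {Γ : List Ty} {τ : Ty} (e₁ e₂ : Tm Γ τ) : Red (.ite .tt e₁ e₂) e₁
  | iteFalse {Γ : List Ty} {τ : Ty} (e₁ e₂ : Tm Γ τ) : Red (.ite .ff e₁ e₂) e₂
  | caseNil {Γ : List Ty} {c : CoreTy} {τ : Ty} (e₁ : Tm Γ τ)
      (e₂ : Tm (.core (.list c) :: .core c :: Γ) τ) : Red (.case .nil e₁ e₂) e₁
  | caseCons {Γ : List Ty} {c : CoreTy} {τ : Ty} (a : Tm Γ (.core c))
      (l : Tm Γ (.core (.list c))) (e₁ : Tm Γ τ) (e₂ : Tm (.core (.list c) :: .core c :: Γ) τ) :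
      Red (.case (.cons a l) e₁ e₂) (e₂.subst (Sb.two l a))
  | bindC {Γ : List Ty} {τ σ : Ty} (e₁ : Tm Γ τ) (e₂ : Tm (τ :: Γ) (.part σ)) :
      Red (.bindC (.unitC e₁) e₂) (e₂.subst (Sb.one e₁))
  | bindM {Γ : List Ty} {τ σ : Ty} (e₁ : Tm Γ τ) (e₂ : Tm (τ :: Γ) (.prob σ)) :
      Red (.bindM (.unitM e₁) e₂) (e₂.subst (Sb.one e₁))
  | add {Γ : List Ty} (a b : ENNReal) :
      Red (.add (.xrealLit a) (.xrealLit b) : Tm Γ _) (.xrealLit (a + b))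
  | congCons₁ {Γ : List Ty} {c : CoreTy} {e₁ e₁' : Tm Γ (.core c)} (e₂ : Tm Γ (.core (.list c))) :
      Red e₁ e₁' → Red (.cons e₁ e₂) (.cons e₁' e₂)
  | congCons₂ {Γ : List Ty} {c : CoreTy} (e₁ : Tm Γ (.core c)) {e₂ e₂' : Tm Γ (.core (.list c))} :
      Red e₂ e₂' → Red (.cons e₁ e₂) (.cons e₁ e₂')
  | congAdd₁ {Γ : List Ty} {e₁ e₁' : Tm Γ (.core .xreal)} (e₂ : Tm Γ (.core .xreal)) :
      Red e₁ e₁' → Red (.add e₁ e₂) (.add e₁' e₂)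
  | congAdd₂ {Γ : List Ty} (e₁ : Tm Γ (.core .xreal)) {e₂ e₂' : Tm Γ (.core .xreal)} :
      Red e₂ e₂' → Red (.add e₁ e₂) (.add e₁ e₂')
  | congApp₁ {Γ : List Ty} {τ σ : Ty} {e₁ e₁' : Tm Γ (.fn τ σ)} (e₂ : Tm Γ τ) :
      Red e₁ e₁' → Red (.app e₁ e₂) (.app e₁' e₂)
  | congApp₂ {Γ : List Ty} {τ σ : Ty} (e₁ : Tm Γ (.fn τ σ)) {e₂ e₂' : Tm Γ τ} :
      Red e₂ e₂' → Red (.app e₁ e₂) (.app e₁ e₂')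
  | congLam {Γ : List Ty} {τ σ : Ty} {e e' : Tm (τ :: Γ) σ} : Red e e' → Red (.lam e) (.lam e')
  | congLetin₁ {Γ : List Ty} {τ σ : Ty} {e₁ e₁' : Tm Γ τ} (e₂ : Tm (τ :: Γ) σ) :
      Red e₁ e₁' → Red (.letin e₁ e₂) (.letin e₁' e₂)
  | congLetin₂ {Γ : List Ty} {τ σ : Ty} (e₁ : Tm Γ τ) {e₂ e₂' : Tm (τ :: Γ) σ} :
      Red e₂ e₂' → Red (.letin e₁ e₂) (.letin e₁ e₂')
  | congLetrec {Γ : List Ty} {τ σ : Ty} {e e' : Tm (τ :: .fn τ (.part σ) :: Γ) (.part σ)} :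
      Red e e' → Red (.letrec e) (.letrec e')
  | congLetrecSN {Γ : List Ty} {τ σ : Ty} {e e' : Tm (τ :: .fn τ σ :: Γ) σ} :
      Red e e' → Red (.letrecSN e) (.letrecSN e')
  | congIte₀ {Γ : List Ty} {τ : Ty} {e e' : Tm Γ (.core .bool)} (e₁ e₂ : Tm Γ τ) :
      Red e e' → Red (.ite e e₁ e₂) (.ite e' e₁ e₂)
  | congIte₁ {Γ : List Ty} {τ : Ty} (e : Tm Γ (.core .bool)) {e₁ e₁' : Tm Γ τ} (e₂ : Tm Γ τ) :
      Red e₁ e₁' → Red (.ite e e₁ e₂) (.ite e e₁' e₂)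
  | congIte₂ {Γ : List Ty} {τ : Ty} (e : Tm Γ (.core .bool)) (e₁ : Tm Γ τ) {e₂ e₂' : Tm Γ τ} :
      Red e₂ e₂' → Red (.ite e e₁ e₂) (.ite e e₁ e₂')
  | congCase₀ {Γ : List Ty} {c : CoreTy} {τ : Ty} {e e' : Tm Γ (.core (.list c))} (e₁ : Tm Γ τ)
      (e₂ : Tm (.core (.list c) :: .core c :: Γ) τ) :
      Red e e' → Red (.case e e₁ e₂) (.case e' e₁ e₂)
  | congCase₁ {Γ : List Ty} {c : CoreTy} {τ : Ty} (e : Tm Γ (.core (.list c))) {e₁ e₁' : Tm Γ τ}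
      (e₂ : Tm (.core (.list c) :: .core c :: Γ) τ) :
      Red e₁ e₁' → Red (.case e e₁ e₂) (.case e e₁' e₂)
  | congCase₂ {Γ : List Ty} {c : CoreTy} {τ : Ty} (e : Tm Γ (.core (.list c))) (e₁ : Tm Γ τ)
      {e₂ e₂' : Tm (.core (.list c) :: .core c :: Γ) τ} :
      Red e₂ e₂' → Red (.case e e₁ e₂) (.case e e₁ e₂')
  | congUnitC {Γ : List Ty} {τ : Ty} {e e' : Tm Γ τ} : Red e e' → Red (.unitC e) (.unitC e')
  | congBindC₁ {Γ : List Ty} {τ σ : Ty} {e₁ e₁' : Tm Γ (.part τ)} (e₂ : Tm (τ :: Γ) (.part σ)) :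
      Red e₁ e₁' → Red (.bindC e₁ e₂) (.bindC e₁' e₂)
  | congBindC₂ {Γ : List Ty} {τ σ : Ty} (e₁ : Tm Γ (.part τ)) {e₂ e₂' : Tm (τ :: Γ) (.part σ)} :
      Red e₂ e₂' → Red (.bindC e₁ e₂) (.bindC e₁ e₂')
  | congUnitM {Γ : List Ty} {τ : Ty} {e e' : Tm Γ τ} : Red e e' → Red (.unitM e) (.unitM e')
  | congBindM₁ {Γ : List Ty} {τ σ : Ty} {e₁ e₁' : Tm Γ (.prob τ)} (e₂ : Tm (τ :: Γ) (.prob σ)) :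
      Red e₁ e₁' → Red (.bindM e₁ e₂) (.bindM e₁' e₂)
  | congBindM₂ {Γ : List Ty} {τ σ : Ty} (e₁ : Tm Γ (.prob τ)) {e₂ e₂' : Tm (τ :: Γ) (.prob σ)} :
      Red e₂ e₂' → Red (.bindM e₁ e₂) (.bindM e₁ e₂')

/-! ### Relational typing -/

/-- `Typed G e e' T` is the judgment `G ⊢ e ~ e' :: T`. The synchronous rules are stated for two
expressions of the same shape; `G ⊢ e :: T` is the case of equal expressions. -/
inductive Typed : {Δ : List Ty} → {τ : Ty} →
    REnv Δ → Tm Δ τ → Tm Δ τ → RTy (dbl Δ) τ → Prop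
  | var {Δ : List Ty} {τ : Ty} (G : REnv Δ) (x : Var Δ τ) :
      Typed G (.var x) (.var x) (G.lookup x)
  | natLit {Δ : List Ty} (G : REnv Δ) (n : ℕ) : Typed G (.natLit n) (.natLit n) (.core .nat)
  | xrealLit {Δ : List Ty} (G : REnv Δ) (a : ENNReal) :
      Typed G (.xrealLit a) (.xrealLit a) (.core .xreal)
  | unit {Δ : List Ty} (G : REnv Δ) : Typed G .unit .unit (.core .unit)
  | ff {Δ : List Ty} (G : REnv Δ) : Typed G .ff .ff (.core .bool)
  | tt {Δ : List Ty} (G : REnv Δ) : Typed G .tt .tt (.core .bool)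
  | nil {Δ : List Ty} (G : REnv Δ) (c : CoreTy) : Typed G .nil .nil (.core (.list c))
  | cons {Δ : List Ty} {G : REnv Δ} {c : CoreTy} {e₁ e₁' : Tm Δ (.core c)}
      {e₂ e₂' : Tm Δ (.core (.list c))} :
      Typed G e₁ e₁' (.core c) → Typed G e₂ e₂' (.core (.list c)) →
      Typed G (.cons e₁ e₂) (.cons e₁' e₂') (.core (.list c))
  | add {Δ : List Ty} {G : REnv Δ} {e₁ e₁' e₂ e₂' : Tm Δ (.core .xreal)} :
      Typed G e₁ e₁' (.core .xreal) → Typed G e₂ e₂' (.core .xreal) →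
      Typed G (.add e₁ e₂) (.add e₁' e₂') (.core .xreal)
  | abs {Δ : List Ty} {τ σ : Ty} {G : REnv Δ} {T : RTy (dbl Δ) τ} {U : RTy (dbl (τ :: Δ)) σ}
      {e e' : Tm (τ :: Δ) σ} :
      Typed (G.bind T) e e' U → Typed G (.lam e) (.lam e') (.pi T U)
  | app {Δ : List Ty} {τ σ : Ty} {G : REnv Δ} {T : RTy (dbl Δ) τ} {U : RTy (dbl (τ :: Δ)) σ}
      {e₁ e₁' : Tm Δ (.fn τ σ)} {e₂ e₂' : Tm Δ τ} :
      Typed G e₁ e₁' (.pi T U) → Typed G e₂ e₂' T →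
      Typed G (.app e₁ e₂) (.app e₁' e₂') (U.subst (Sb.two e₂.left e₂'.right))
  | letin {Δ : List Ty} {τ σ : Ty} {G : REnv Δ} {T : RTy (dbl Δ) τ} {U : RTy (dbl (τ :: Δ)) σ}
      {e₁ e₁' : Tm Δ τ} {e₂ e₂' : Tm (τ :: Δ) σ} :
      Typed G e₁ e₁' T → Typed (G.bind T) e₂ e₂' U →
      Typed G (.letin e₁ e₂) (.letin e₁' e₂') (U.subst (Sb.two e₁.left e₁'.right))
  /-- The premise after the typing of the body is the guard: both recursions terminate, and the
  type given to the recursive variable has an element, i.e. assuming it is not contradictory. -/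
  | letrecSN {Δ : List Ty} {τ σ : Ty} {G : REnv Δ} {T : RTy (dbl Δ) τ}
      {U : RTy (dbl (τ :: Δ)) σ} {e e' : Tm (τ :: .fn τ σ :: Δ) σ} :
      Typed (G.bind (.pi T U)) (.lam e) (.lam e') ((RTy.pi T U).ren Ren.wk2) →
      (∀ θ, G.Valid θ →
        Terminating ((e.ren leftVar.lift.lift).functional θ) ∧
        Terminating ((e'.ren rightVar.lift.lift).functional θ) ∧
        ((RTy.pi T U).den θ).Nonempty) →
      Typed G (.letrecSN e) (.letrecSN e') (.pi T U)
  | letrec {Δ : List Ty} {τ σ : Ty} {G : REnv Δ} {T : RTy (dbl Δ) τ}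
      {U : RTy (dbl (τ :: Δ)) σ} {e e' : Tm (τ :: .fn τ (.part σ) :: Δ) (.part σ)} :
      Typed (G.bind (.pi T (.part U))) (.lam e) (.lam e') ((RTy.pi T (.part U)).ren Ren.wk2) →
      Typed G (.letrec e) (.letrec e') (.pi T (.part U))
  | ite {Δ : List Ty} {τ : Ty} {G : REnv Δ} {T : RTy (dbl Δ) τ} {e e' : Tm Δ (.core .bool)}
      {e₁ e₁' e₂ e₂' : Tm Δ τ} :
      Typed G e e' (.core .bool) →
      (∀ θ, G.Valid θ → (e.left.den θ = true ↔ e'.right.den θ = true)) →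
      Typed (G.hyp (.and (.eq e.left .tt) (.eq e'.right .tt))) e₁ e₁' T →
      Typed (G.hyp (.and (.eq e.left .ff) (.eq e'.right .ff))) e₂ e₂' T →
      Typed G (.ite e e₁ e₂) (.ite e' e₁' e₂') T
  | case {Δ : List Ty} {c : CoreTy} {τ : Ty} {G : REnv Δ} {T : RTy (dbl Δ) τ}
      {e e' : Tm Δ (.core (.list c))} {e₁ e₁' : Tm Δ τ}
      {e₂ e₂' : Tm (.core (.list c) :: .core c :: Δ) τ} :
      Typed G e e' (.core (.list c)) →
      (∀ θ, G.Valid θ → (e.left.den θ = [] ↔ e'.right.den θ = [])) →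
      Typed G e₁ e₁' T →
      Typed (((G.bind (.core c)).bind (.core (.list c))).hyp
          (.and (.eq (e.left.ren Ren.wk4) (.cons (.var (.s (.s .z))) (.var .z)))
            (.eq (e'.right.ren Ren.wk4) (.cons (.var (.s (.s (.s .z)))) (.var (.s .z))))))
        e₂ e₂' (T.ren Ren.wk4) →
      Typed G (.case e e₁ e₂) (.case e' e₁' e₂') T
  | unitC {Δ : List Ty} {τ : Ty} {G : REnv Δ} {T : RTy (dbl Δ) τ} {e e' : Tm Δ τ} :
      Typed G e e' T → Typed G (.unitC e) (.unitC e') (.part T)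
  | bindC {Δ : List Ty} {τ σ : Ty} {G : REnv Δ} {T₁ : RTy (dbl Δ) τ} {T₂ : RTy (dbl Δ) σ}
      {e₁ e₁' : Tm Δ (.part τ)} {e₂ e₂' : Tm (τ :: Δ) (.part σ)} :
      Typed G e₁ e₁' (.part T₁) →
      Typed (G.bind T₁) e₂ e₂' ((RTy.part T₂).ren Ren.wk2) →
      Typed G (.bindC e₁ e₂) (.bindC e₁' e₂') (.part T₂)
  | unitM {Δ : List Ty} {τ : Ty} {G : REnv Δ} {T : RTy (dbl Δ) τ} {e e' : Tm Δ τ}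
      (ε δ : Tm (dbl Δ) (.core .xreal)) :
      Typed G e e' T → Typed G (.unitM e) (.unitM e') (.prob ε δ T)
  | bindM {Δ : List Ty} {τ σ : Ty} {G : REnv Δ} {T₁ : RTy (dbl Δ) τ} {T₂ : RTy (dbl Δ) σ}
      {ε₁ δ₁ ε₂ δ₂ : Tm (dbl Δ) (.core .xreal)}
      {e₁ e₁' : Tm Δ (.prob τ)} {e₂ e₂' : Tm (τ :: Δ) (.prob σ)} :
      Typed G e₁ e₁' (.prob ε₁ δ₁ T₁) →
      Typed (G.bind T₁) e₂ e₂' ((RTy.prob ε₂ δ₂ T₂).ren Ren.wk2) →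
      Typed G (.bindM e₁ e₂) (.bindM e₁' e₂') (.prob (.add ε₁ ε₂) (.add δ₁ δ₂) T₂)
  | sub {Δ : List Ty} {τ : Ty} {G : REnv Δ} {T U : RTy (dbl Δ) τ} {e e' : Tm Δ τ} :
      Typed G e e' T → Subty G T U → Typed G e e' U
  | redLeft {Δ : List Ty} {τ : Ty} {G : REnv Δ} {T : RTy (dbl Δ) τ} {e₁ e₁' e₂ : Tm Δ τ} :
      Red e₁ e₁' → Typed G e₁ e₂ T → Typed G e₁' e₂ T
  | redRight {Δ : List Ty} {τ : Ty} {G : REnv Δ} {T : RTy (dbl Δ) τ} {e₁ e₂ e₂' : Tm Δ τ} :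
      Red e₂ e₂' → Typed G e₁ e₂ T → Typed G e₁ e₂' T
  | iteLeft {Δ : List Ty} {τ : Ty} {G : REnv Δ} {T : RTy (dbl Δ) τ} {e : Tm Δ (.core .bool)}
      {e₁ e₂ e' : Tm Δ τ} :
      Typed (G.hyp (.eq e.left .tt)) e₁ e' T →
      Typed (G.hyp (.eq e.left .ff)) e₂ e' T →
      Typed G (.ite e e₁ e₂) e' T
  | iteRight {Δ : List Ty} {τ : Ty} {G : REnv Δ} {T : RTy (dbl Δ) τ} {e : Tm Δ (.core .bool)}
      {e₁ e₂ e' : Tm Δ τ} :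
      Typed (G.hyp (.eq e.right .tt)) e' e₁ T →
      Typed (G.hyp (.eq e.right .ff)) e' e₂ T →
      Typed G e' (.ite e e₁ e₂) T
  | caseLeft {Δ : List Ty} {c : CoreTy} {τ : Ty} {G : REnv Δ} {T : RTy (dbl Δ) τ}
      {e : Tm Δ (.core (.list c))} {e₁ e' : Tm Δ τ}
      {e₂ : Tm (.core (.list c) :: .core c :: Δ) τ} :
      Typed (G.hyp (.eq e.left .nil)) e₁ e' T →
      Typed (((G.bind (.core c)).bind (.core (.list c))).hyp
          (.eq (e.left.ren Ren.wk4) (.cons (.var (.s (.s .z))) (.var .z))))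
        e₂ (e'.ren Ren.wk2) (T.ren Ren.wk4) →
      Typed G (.case e e₁ e₂) e' T
  | caseRight {Δ : List Ty} {c : CoreTy} {τ : Ty} {G : REnv Δ} {T : RTy (dbl Δ) τ}
      {e : Tm Δ (.core (.list c))} {e₁ e' : Tm Δ τ}
      {e₂ : Tm (.core (.list c) :: .core c :: Δ) τ} :
      Typed (G.hyp (.eq e.right .nil)) e' e₁ T →
      Typed (((G.bind (.core c)).bind (.core (.list c))).hyp
          (.eq (e.right.ren Ren.wk4) (.cons (.var (.s (.s (.s .z)))) (.var (.s .z)))))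
        (e'.ren Ren.wk2) e₂ (T.ren Ren.wk4) →
      Typed G e' (.case e e₁ e₂) T

end HOARe

/-!
Soundness is proved by induction on the typing derivation, each rule being valid for the
interpretation of relational types as sets of pairs. The rules whose conclusion involves renaming or
substitution rest on the fact that these operations act on valuations (`Tm.den_ren`,
`Tm.den_subst`, `RTy.den_ren`, `RTy.den_subst`). In particular `e◁` and `e▷` denote `e` in the left
and the right half of the valuation, and `Red.den_eq` lets the one-sided reduction rules replace an
expression by one with the same denotation.

The other rules with content are those for recursion and for the probability monad.

* For `letrec`, all pairs of iterates `(F₁ⁿ(⊥), F₂ⁿ(⊥))` belong to the type, as `(⊥, ⊥)` does. At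
  related arguments the two sides therefore become defined at the same `n`, with related values
  (`kleene_related`); no continuity is needed. For `letrec↓`, the iteration starts at any pair in
  the type, and is stable at each argument after finitely many steps (`kleeneSN_related`).
* For `bind` of distributions, the witnesses of the `(ε₂, δ₂)`-liftings are averaged over the
  witness of the `(ε₁, δ₁)`-lifting (`Lifting.bind`). The bound on distances (`epsDist_bind_le`)
  holds because `μ(E) ≤ e^ε ν(E) + δ` for all events `E` implies the same inequality for the
  integrals of any `[0, 1]`-valued function, here the excess `M a (E) - δ₂`.
-/

namespace HOARe

/-! ### Renaming and substitution act on valuations -/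

/-- The valuation of `Γ` read off from one of `Γ'` along a renaming. -/
def Env.ren {Γ Γ' : List Ty} (ρ : Ren Γ Γ') (θ : Env Γ') : Env Γ := fun _ x => θ _ (ρ _ x)

theorem Env.ren_lift {Γ Γ' : List Ty} (ρ : Ren Γ Γ') {σ : Ty} (d : σ.den) (θ : Env Γ') :
    (θ.cons d).ren (ρ.lift (σ := σ)) = (θ.ren ρ).cons d := by
  funext τ x; cases x <;> rfl

theorem Tm.den_ren {Γ : List Ty} {τ : Ty} (e : Tm Γ τ) {Γ' : List Ty} (ρ : Ren Γ Γ')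
    (θ : Env Γ') : (e.ren ρ).den θ = e.den (θ.ren ρ) := by
  induction e generalizing Γ' with
  | case e e₁ e₂ ih ih₁ ih₂ =>
    simp only [Tm.ren, Tm.den, ih, ih₁, ih₂, Env.ren_lift]
  | var x => rfl
  | _ => simp only [Tm.ren, Tm.den, Env.ren_lift, *]

/-- The valuation of `Γ` that gives each variable the denotation of the term substituted for it. -/
noncomputable def Env.subst {Γ Γ' : List Ty} (ξ : Sb Γ Γ') (θ : Env Γ') : Env Γ :=
  fun _ x => (ξ _ x).den θ

theorem Env.subst_lift {Γ Γ' : List Ty} (ξ : Sb Γ Γ') {σ : Ty} (d : σ.den) (θ : Env Γ') :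
    (θ.cons d).subst (ξ.lift (σ := σ)) = (θ.subst ξ).cons d := by
  funext τ x
  cases x with
  | z => rfl
  | s x => exact Tm.den_ren _ _ _

theorem Tm.den_subst {Γ : List Ty} {τ : Ty} (e : Tm Γ τ) {Γ' : List Ty} (ξ : Sb Γ Γ')
    (θ : Env Γ') : (e.subst ξ).den θ = e.den (θ.subst ξ) := by
  induction e generalizing Γ' with
  | case e e₁ e₂ ih ih₁ ih₂ =>
    simp only [Tm.subst, Tm.den, ih, ih₁, ih₂, Env.subst_lift]
  | var x => rfl
  | _ => simp only [Tm.subst, Tm.den, Env.subst_lift, *]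

theorem Env.subst_one {Γ : List Ty} {σ : Ty} (e : Tm Γ σ) (θ : Env Γ) :
    θ.subst (Sb.one e) = θ.cons (e.den θ) := by
  funext τ x; cases x <;> rfl

theorem Env.subst_two {Γ : List Ty} {σ₀ σ₁ : Ty} (e₀ : Tm Γ σ₀) (e₁ : Tm Γ σ₁) (θ : Env Γ) :
    θ.subst (Sb.two e₀ e₁) = (θ.cons (e₁.den θ)).cons (e₀.den θ) := by
  funext τ x
  rcases x with _ | x
  · rfl
  · cases x <;> rfl

mutual

theorem RTy.den_ren {Γ : List Ty} {τ : Ty} : (T : RTy Γ τ) → {Γ' : List Ty} → (ρ : Ren Γ Γ') →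
    (θ : Env Γ') → (T.ren ρ).den θ = T.den (θ.ren ρ)
  | .core c, _, ρ, θ => rfl
  | .prob ε δ T, _, ρ, θ => by simp only [RTy.ren, RTy.den, Tm.den_ren, RTy.den_ren T]
  | .part T, _, ρ, θ => by simp only [RTy.ren, RTy.den, RTy.den_ren T]
  | .pi T U, _, ρ, θ => by
    simp only [RTy.ren, RTy.den, RTy.den_ren T, RTy.den_ren U, Env.ren_lift]
  | .ref T φ, _, ρ, θ => by
    simp only [RTy.ren, RTy.den, RTy.den_ren T, Assn.den_ren φ, Env.ren_lift]

theorem Assn.den_ren {Γ : List Ty} : (φ : Assn Γ) → {Γ' : List Ty} → (ρ : Ren Γ Γ') →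
    (θ : Env Γ') → (φ.ren ρ).den θ = φ.den (θ.ren ρ)
  | .allP τ φ, _, ρ, θ => by simp only [Assn.ren, Assn.den, Assn.den_ren φ, Env.ren_lift]
  | .exP τ φ, _, ρ, θ => by simp only [Assn.ren, Assn.den, Assn.den_ren φ, Env.ren_lift]
  | .allR T φ, _, ρ, θ => by
    simp only [Assn.ren, Assn.den, RTy.den_ren T, Assn.den_ren φ, Env.ren_lift]
  | .exR T φ, _, ρ, θ => by
    simp only [Assn.ren, Assn.den, RTy.den_ren T, Assn.den_ren φ, Env.ren_lift]
  | .top, _, _, _ => rfl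
  | .bot, _, _, _ => rfl
  | .not φ, _, ρ, θ => by simp only [Assn.ren, Assn.den, Assn.den_ren φ]
  | .or φ ψ, _, ρ, θ => by simp only [Assn.ren, Assn.den, Assn.den_ren φ, Assn.den_ren ψ]
  | .and φ ψ, _, ρ, θ => by simp only [Assn.ren, Assn.den, Assn.den_ren φ, Assn.den_ren ψ]
  | .imp φ ψ, _, ρ, θ => by simp only [Assn.ren, Assn.den, Assn.den_ren φ, Assn.den_ren ψ]
  | .eq e₁ e₂, _, ρ, θ => by simp only [Assn.ren, Assn.den, Tm.den_ren]
  | .le n e₁ e₂, _, ρ, θ => by simp only [Assn.ren, Assn.den, Tm.den_ren]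

end

mutual

theorem RTy.den_subst {Γ : List Ty} {τ : Ty} : (T : RTy Γ τ) → {Γ' : List Ty} → (ξ : Sb Γ Γ') →
    (θ : Env Γ') → (T.subst ξ).den θ = T.den (θ.subst ξ)
  | .core c, _, ξ, θ => rfl
  | .prob ε δ T, _, ξ, θ => by simp only [RTy.subst, RTy.den, Tm.den_subst, RTy.den_subst T]
  | .part T, _, ξ, θ => by simp only [RTy.subst, RTy.den, RTy.den_subst T]
  | .pi T U, _, ξ, θ => by
    simp only [RTy.subst, RTy.den, RTy.den_subst T, RTy.den_subst U, Env.subst_lift]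
  | .ref T φ, _, ξ, θ => by
    simp only [RTy.subst, RTy.den, RTy.den_subst T, Assn.den_subst φ, Env.subst_lift]

theorem Assn.den_subst {Γ : List Ty} : (φ : Assn Γ) → {Γ' : List Ty} → (ξ : Sb Γ Γ') →
    (θ : Env Γ') → (φ.subst ξ).den θ = φ.den (θ.subst ξ)
  | .allP τ φ, _, ξ, θ => by simp only [Assn.subst, Assn.den, Assn.den_subst φ, Env.subst_lift]
  | .exP τ φ, _, ξ, θ => by simp only [Assn.subst, Assn.den, Assn.den_subst φ, Env.subst_lift]
  | .allR T φ, _, ξ, θ => by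
    simp only [Assn.subst, Assn.den, RTy.den_subst T, Assn.den_subst φ, Env.subst_lift]
  | .exR T φ, _, ξ, θ => by
    simp only [Assn.subst, Assn.den, RTy.den_subst T, Assn.den_subst φ, Env.subst_lift]
  | .top, _, _, _ => rfl
  | .bot, _, _, _ => rfl
  | .not φ, _, ξ, θ => by simp only [Assn.subst, Assn.den, Assn.den_subst φ]
  | .or φ ψ, _, ξ, θ => by simp only [Assn.subst, Assn.den, Assn.den_subst φ, Assn.den_subst ψ]
  | .and φ ψ, _, ξ, θ => by simp only [Assn.subst, Assn.den, Assn.den_subst φ, Assn.den_subst ψ]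
  | .imp φ ψ, _, ξ, θ => by simp only [Assn.subst, Assn.den, Assn.den_subst φ, Assn.den_subst ψ]
  | .eq e₁ e₂, _, ξ, θ => by simp only [Assn.subst, Assn.den, Tm.den_subst]
  | .le n e₁ e₂, _, ξ, θ => by simp only [Assn.subst, Assn.den, Tm.den_subst]

end

/-! ### Recursive functions as fixed points -/

/-- For continuous `F` the union of the iterates is their least upper bound, hence a fixed point. -/
theorem kleene_fixed {α β : Type} {F : (α → Part β) → α → Part β}
    (hF : OmegaCompletePartialOrder.ωScottContinuous F) : F (kleene F) = kleene F := by
  have hmono : Monotone F := hF.monotone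
  let c : OmegaCompletePartialOrder.Chain (α → Part β) :=
    ⟨fun n => F^[n] ⊥, hmono.monotone_iterate_of_le_map bot_le⟩
  have hlub : IsLUB (Set.range c) (kleene F) := by
    refine ⟨?_, fun u hu a b hb => ?_⟩
    · rintro _ ⟨n, rfl⟩ a b hb
      exact (mem_kleene_iff hmono a b).2 ⟨n, hb⟩
    · obtain ⟨n, hn⟩ := (mem_kleene_iff hmono a b).1 hb
      exact hu ⟨n, rfl⟩ a b hn
  have hs : OmegaCompletePartialOrder.ωSup c = kleene F :=
    (OmegaCompletePartialOrder.isLUB_range_ωSup c).unique hlub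
  have h := hF.map_ωSup c
  rw [hs] at h
  rw [h, ← hs]
  apply le_antisymm
  · refine OmegaCompletePartialOrder.ωSup_le _ _ fun n => ?_
    have : F^[n + 1] ⊥ ≤ OmegaCompletePartialOrder.ωSup c :=
      OmegaCompletePartialOrder.le_ωSup c (n + 1)
    rwa [Function.iterate_succ_apply'] at this
  · refine OmegaCompletePartialOrder.ωSup_le _ _ fun n => ?_
    refine le_trans (c.monotone (Nat.le_succ n)) ?_
    have : F (F^[n] ⊥) ≤ OmegaCompletePartialOrder.ωSup (c.map ⟨F, hmono⟩) :=
      OmegaCompletePartialOrder.le_ωSup (c.map ⟨F, hmono⟩) n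
    rwa [← Function.iterate_succ_apply' F] at this

/-- The `n`-th iterate of a terminating functional no longer depends on its starting point at
arguments of size less than `n`. -/
theorem iterate_eq_of_size_lt {α β : Type} {F : (α → β) → α → β} {r : α → ℕ}
    (hr : ∀ (a : α) (d d' : α → β), (∀ b, r b < r a → d b = d' b) → F d a = F d' a)
    (n : ℕ) (a : α) (ha : r a < n) (d d' : α → β) : F^[n] d a = F^[n] d' a := by
  induction n generalizing a with
  | zero => omega
  | succ n ih =>
    rw [Function.iterate_succ_apply', Function.iterate_succ_apply']
    exact hr _ _ _ fun b hb => ih b (by omega)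

/-- A terminating recursion is computed at `a` by any iterate of order greater than the size of `a`,
from any starting point. -/
theorem kleeneSN_eq {α β : Type} (b₀ : β) {F : (α → β) → α → β} {r : α → ℕ}
    (hr : ∀ (a : α) (d d' : α → β), (∀ b, r b < r a → d b = d' b) → F d a = F d' a)
    (n : ℕ) (a : α) (ha : r a < n) (d : α → β) : kleeneSN b₀ F a = F^[n] d a := by
  have h : ∃ b : β, ∃ n : ℕ, ∀ d : α → β, (F^[n] d) a = b :=
    ⟨_, n, fun d' => iterate_eq_of_size_lt hr n a ha d' d⟩
  rw [kleeneSN, dif_pos h]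
  obtain ⟨m, hm⟩ := h.choose_spec
  -- Compare both values with the iterate of order `m + n`.
  rw [← hm (F^[n] d), ← Function.iterate_add_apply, Nat.add_comm, Function.iterate_add_apply]
  exact iterate_eq_of_size_lt hr n a ha _ _

theorem kleeneSN_fixed {α β : Type} (b₀ : β) {F : (α → β) → α → β} (hF : Terminating F) :
    F (kleeneSN b₀ F) = kleeneSN b₀ F := by
  obtain ⟨r, hr⟩ := hF
  funext a
  rw [kleeneSN_eq b₀ hr (r a + 1) a (Nat.lt_succ_self _) fun _ => b₀,
    Function.iterate_succ_apply']
  exact hr _ _ _ fun b hb => kleeneSN_eq b₀ hr _ b hb _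

/-! ### Reduction -/

/-- Reduction preserves denotations. The side conditions on unfolding are what makes a recursive
function a fixed point of its functional. -/
theorem Red.den_eq {Γ : List Ty} {τ : Ty} {e e' : Tm Γ τ} (h : Red e e') (θ : Env Γ) :
    e.den θ = e'.den θ := by
  induction h with
  | beta e e' => simp only [Tm.den, Tm.den_subst, Env.subst_one]
  | letin e₁ e₂ => simp only [Tm.den, Tm.den_subst, Env.subst_one]
  | letrec e e' hc =>
    rw [Tm.den_subst, Env.subst_two]
    exact (congrFun (kleene_fixed (hc θ)) (e'.den θ)).symm
  | letrecSN e e' hc =>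
    rw [Tm.den_subst, Env.subst_two]
    exact (congrFun (kleeneSN_fixed _ (hc θ)) (e'.den θ)).symm
  | caseCons a l e₁ e₂ => simp only [Tm.den, Tm.den_subst, Env.subst_two]
  | bindC e₁ e₂ => simp only [Tm.den, Tm.den_subst, Env.subst_one, Part.bind_some]
  | bindM e₁ e₂ => simp only [Tm.den, Tm.den_subst, Env.subst_one, PMF.pure_bind]
  | _ => first | rfl | simp only [Tm.den, *]

/-! ### Distances and liftings -/

theorem one_le_exp_coe (ε : ENNReal) : 1 ≤ EReal.exp (ε : EReal) := by
  rw [← EReal.exp_zero]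
  exact EReal.exp_monotone (EReal.coe_ennreal_nonneg ε)

theorem exp_coe_add (ε₁ ε₂ : ENNReal) :
    EReal.exp ((ε₁ + ε₂ : ENNReal) : EReal) = EReal.exp (ε₁ : EReal) * EReal.exp (ε₂ : EReal) := by
  rw [EReal.coe_ennreal_add, EReal.exp_add]

/-- The `ε`-distance in additive form, free of truncated subtraction. -/
theorem epsDist_le_iff {α : Type} {ε δ : ENNReal} {μ ν : α → ENNReal} :
    epsDist ε μ ν ≤ δ ↔ ∀ E : Set α,
      ∑' a, E.indicator μ a ≤ δ + EReal.exp (ε : EReal) * ∑' a, E.indicator ν a := by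
  simp only [epsDist, iSup_le_iff, tsub_le_iff_right]

theorem epsDist_self {α : Type} (ε : ENNReal) (μ : α → ENNReal) : epsDist ε μ μ = 0 := by
  refine le_antisymm (epsDist_le_iff.2 fun E => ?_) (zero_le)
  rw [zero_add]
  exact le_mul_of_one_le_left (zero_le) (one_le_exp_coe ε)

theorem epsDist_anti {α : Type} {ε₁ ε₂ : ENNReal} (h : ε₁ ≤ ε₂) (μ ν : α → ENNReal) :
    epsDist ε₂ μ ν ≤ epsDist ε₁ μ ν :=
  iSup_mono fun _ => tsub_le_tsub_left
    (mul_le_mul_left (EReal.exp_monotone (EReal.coe_ennreal_le_coe_ennreal_iff.2 h)) _) _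

/-- The bound on events `E` in the definition of `epsDist` extends to `[0, 1]`-valued
functions `g`. -/
theorem tsum_mul_le_of_epsDist_le {α : Type} {ε δ : ENNReal} {μ ν g : α → ENNReal}
    (hμ : ∑' a, μ a ≠ ⊤) (hd : epsDist ε μ ν ≤ δ) (hg : ∀ a, g a ≤ 1) :
    ∑' a, μ a * g a ≤ δ + EReal.exp (ε : EReal) * ∑' a, ν a * g a := by
  set k := EReal.exp (ε : EReal) with hk
  -- The set where `μ` exceeds `e^ε ν` maximises `μ(E) - e^ε ν(E)`.
  let E : Set α := {a | k * ν a < μ a}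
  have hE : ∑' a, E.indicator μ a ≤ δ + k * ∑' a, E.indicator ν a := epsDist_le_iff.1 hd E
  have hsplit : ∑' a, E.indicator μ a
      = ∑' a, (μ a - k * ν a) + k * ∑' a, E.indicator ν a := by
    rw [← ENNReal.tsum_mul_left, ← ENNReal.tsum_add]
    refine tsum_congr fun a => ?_
    by_cases ha : a ∈ E
    · rw [Set.indicator_of_mem ha, Set.indicator_of_mem ha]
      exact (tsub_add_cancel_of_le (le_of_lt ha)).symm
    · rw [Set.indicator_of_notMem ha, Set.indicator_of_notMem ha, mul_zero, add_zero]
      exact (tsub_eq_zero_of_le (not_lt.1 ha)).symm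
  have hfin : k * ∑' a, E.indicator ν a ≠ ⊤ := by
    refine ne_top_of_le_ne_top (ne_top_of_le_ne_top hμ ?_) (hsplit ▸ le_add_self)
    exact ENNReal.tsum_le_tsum fun a => Set.indicator_le_self _ _ a
  have hexc : ∑' a, (μ a - k * ν a) ≤ δ := by
    rw [hsplit] at hE
    exact (ENNReal.add_le_add_iff_right hfin).1 hE
  calc ∑' a, μ a * g a
      ≤ ∑' a, ((μ a - k * ν a) + k * (ν a * g a)) := by
        refine ENNReal.tsum_le_tsum fun a => ?_
        calc μ a * g a ≤ ((μ a - k * ν a) + k * ν a) * g a :=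
              mul_le_mul_left le_tsub_add _
          _ = (μ a - k * ν a) * g a + k * (ν a * g a) := by rw [add_mul, mul_assoc]
          _ ≤ _ := add_le_add_left (mul_le_of_le_one_right (zero_le) (hg a)) _
    _ = ∑' a, (μ a - k * ν a) + k * ∑' a, ν a * g a := by
        rw [ENNReal.tsum_add, ENNReal.tsum_mul_left]
    _ ≤ _ := add_le_add_left hexc _

theorem tsum_indicator_tsum_mul {ι γ : Type} (w : ι → ENNReal) (f : ι → γ → ENNReal)
    (E : Set γ) : ∑' c, E.indicator (fun c => ∑' i, w i * f i c) c
      = ∑' i, w i * ∑' c, E.indicator (f i) c := by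
  calc ∑' c, E.indicator (fun c => ∑' i, w i * f i c) c
      = ∑' c, ∑' i, w i * E.indicator (f i) c := by
        refine tsum_congr fun c => ?_
        by_cases hc : c ∈ E <;> simp [hc]
    _ = _ := by rw [ENNReal.tsum_comm]; simp only [ENNReal.tsum_mul_left]

/-- One-sided composition: the distances from `p` to the first marginal of `μ`, and from `M a` to
`ν (a, b)` at every pair `(a, b)` charged by `μ`, add up under monadic composition. -/
theorem epsDist_bind_le {α β γ : Type} {ε₁ δ₁ ε₂ δ₂ : ENNReal} (p : PMF α) (M : α → PMF γ)
    (μ : α × β → ENNReal) (ν : α × β → γ → ENNReal)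
    (hμ : epsDist ε₁ p (marginalFst μ) ≤ δ₁)
    (hν : ∀ q, 0 < μ q → epsDist ε₂ (M q.1) (ν q) ≤ δ₂) :
    epsDist (ε₁ + ε₂) (p.bind M) (fun c => ∑' q, μ q * ν q c) ≤ δ₁ + δ₂ := by
  rw [epsDist_le_iff]
  intro E
  -- `M a` exceeds `δ₂` on `E` by at most `e^ε₂ ν (a, b)(E)`, for every `b` paired with `a`. The
  -- excess `g` does not depend on `b`, so it can be integrated against the marginal alone.
  let g : α → ENNReal := fun a => (∑' c, E.indicator (M a) c) - δ₂
  have hg : ∀ a, g a ≤ 1 := fun a => tsub_le_self.trans <|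
    (ENNReal.tsum_le_tsum fun c => Set.indicator_le_self _ _ c).trans_eq (M a).tsum_coe
  have h1 : ∑' c, E.indicator (p.bind M) c ≤ ∑' a, p a * g a + δ₂ := by
    calc ∑' c, E.indicator (p.bind M) c = ∑' a, p a * ∑' c, E.indicator (M a) c := by
          rw [← tsum_indicator_tsum_mul]
          exact tsum_congr fun c =>
            congrArg (fun f => E.indicator f c) (funext fun c => p.bind_apply M c)
      _ ≤ ∑' a, (p a * g a + p a * δ₂) := by
          refine ENNReal.tsum_le_tsum fun a => ?_
          rw [← mul_add]
          exact mul_le_mul_right le_tsub_add _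
      _ = _ := by rw [ENNReal.tsum_add, ENNReal.tsum_mul_right, p.tsum_coe, one_mul]
  have h2 := tsum_mul_le_of_epsDist_le (p.tsum_coe.symm ▸ ENNReal.one_ne_top) hμ hg
  have h3 : ∑' a, marginalFst μ a * g a
      ≤ EReal.exp (ε₂ : EReal) * ∑' q, μ q * ∑' c, E.indicator (ν q) c := by
    calc ∑' a, marginalFst μ a * g a = ∑' q : α × β, μ q * g q.1 := by
          rw [ENNReal.tsum_prod']
          simp only [marginalFst, ENNReal.tsum_mul_right]
      _ ≤ ∑' q, EReal.exp (ε₂ : EReal) * (μ q * ∑' c, E.indicator (ν q) c) := by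
          refine ENNReal.tsum_le_tsum fun q => ?_
          rcases eq_or_ne (μ q) 0 with hq | hq
          · simp [hq]
          · rw [mul_left_comm]
            refine mul_le_mul_right (tsub_le_iff_left.2 ?_) _
            exact epsDist_le_iff.1 (hν q (pos_iff_ne_zero.2 hq)) E
      _ = _ := ENNReal.tsum_mul_left
  rw [exp_coe_add, tsum_indicator_tsum_mul, mul_assoc]
  calc _ ≤ _ := h1
    _ ≤ _ := add_le_add_left (h2.trans (add_le_add_right (mul_le_mul_right h3 _) _)) _
    _ = _ := by ring

theorem marginalFst_tsum_mul {ι α β : Type} (w : ι → ENNReal) (ν : ι → α × β → ENNReal) :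
    marginalFst (fun r => ∑' i, w i * ν i r) = fun a => ∑' i, w i * marginalFst (ν i) a := by
  funext a
  simp only [marginalFst]
  rw [ENNReal.tsum_comm]
  simp only [ENNReal.tsum_mul_left]

theorem marginalSnd_tsum_mul {ι α β : Type} (w : ι → ENNReal) (ν : ι → α × β → ENNReal) :
    marginalSnd (fun r => ∑' i, w i * ν i r) = fun b => ∑' i, w i * marginalSnd (ν i) b :=
  marginalFst_tsum_mul w fun i (q : β × α) => ν i q.swap

theorem tsum_mul_le_bind {α β γ : Type} {p : PMF α} {M : α → PMF γ} {μ : α × β → ENNReal}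
    {ν : α × β → γ → ENNReal} (hμ : ∀ a, marginalFst μ a ≤ p a)
    (hν : ∀ q, 0 < μ q → ∀ c, ν q c ≤ M q.1 c) (c : γ) :
    ∑' q, μ q * ν q c ≤ p.bind M c := by
  calc ∑' q, μ q * ν q c ≤ ∑' q, μ q * M q.1 c := by
        refine ENNReal.tsum_le_tsum fun q => ?_
        rcases eq_or_ne (μ q) 0 with hq | hq
        · simp [hq]
        · exact mul_le_mul_right (hν q (pos_iff_ne_zero.2 hq) c) _
    _ = ∑' a, marginalFst μ a * M a c := by
        rw [ENNReal.tsum_prod']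
        simp only [marginalFst, ENNReal.tsum_mul_right]
    _ ≤ ∑' a, p a * M a c := ENNReal.tsum_le_tsum fun a => mul_le_mul_left (hμ a) _
    _ = p.bind M c := (p.bind_apply M c).symm

/-- Sequential composition of liftings: the witness is the `μ`-average of witnesses for the pairs
charged by `μ`. -/
theorem Lifting.bind {α β γ κ : Type} {ε₁ δ₁ ε₂ δ₂ : ENNReal} {Ψ : Set (α × β)}
    {Φ : Set (γ × κ)} {p₁ : PMF α} {p₂ : PMF β} {M₁ : α → PMF γ} {M₂ : β → PMF κ}
    (h : Lifting ε₁ δ₁ Ψ p₁ p₂)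
    (hM : ∀ a b, (a, b) ∈ Ψ → Lifting ε₂ δ₂ Φ (M₁ a) (M₂ b)) :
    Lifting (ε₁ + ε₂) (δ₁ + δ₂) Φ (p₁.bind M₁) (p₂.bind M₂) := by
  obtain ⟨μ, hmass, hsupp, ⟨hle₁, hle₂⟩, hd₁, hd₂⟩ := h
  have hM' : ∀ q, 0 < μ q → Lifting ε₂ δ₂ Φ (M₁ q.1) (M₂ q.2) := fun q hq => hM _ _ (hsupp q hq)
  choose! ν νmass νsupp νle νd₁ νd₂ using hM'
  -- The exchange of both sides, which reduces the second marginal to the first.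
  have hcomm : ∀ f : κ → α × β → ENNReal, (fun b => ∑' q, μ q * f b q)
      = fun b => ∑' q : β × α, μ q.swap * f b q.swap := fun f => funext fun b =>
    ((Equiv.prodComm β α).tsum_eq fun q => μ q * f b q).symm
  refine ⟨fun r => ∑' q, μ q * ν q r, ?_, ?_, ⟨?_, ?_⟩, ?_, ?_⟩
  · rw [ENNReal.tsum_comm]
    simp only [ENNReal.tsum_mul_left]
    refine le_trans (ENNReal.tsum_le_tsum fun q => ?_) hmass
    rcases eq_or_ne (μ q) 0 with hq | hq
    · simp [hq]
    · exact mul_le_of_le_one_right (zero_le) (νmass q (pos_iff_ne_zero.2 hq))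
  · intro r hr
    obtain ⟨q, hq⟩ := not_forall.1 fun h0 => hr.ne' (ENNReal.tsum_eq_zero.2 h0)
    have hq' := mul_ne_zero_iff.1 hq
    exact νsupp q (pos_iff_ne_zero.2 hq'.1) r (pos_iff_ne_zero.2 hq'.2)
  · rw [marginalFst_tsum_mul]
    exact tsum_mul_le_bind hle₁ fun q hq => (νle q hq).1
  · rw [marginalSnd_tsum_mul, hcomm fun b q => marginalSnd (ν q) b]
    exact tsum_mul_le_bind (μ := fun q : β × α => μ q.swap)
      (ν := fun q => marginalSnd (ν q.swap)) hle₂ fun q hq => (νle q.swap hq).2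
  · rw [marginalFst_tsum_mul]
    exact epsDist_bind_le p₁ M₁ μ (fun q => marginalFst (ν q)) hd₁ νd₁
  · rw [marginalSnd_tsum_mul, hcomm fun b q => marginalSnd (ν q) b]
    exact epsDist_bind_le p₂ M₂ (fun q : β × α => μ q.swap) (fun q => marginalSnd (ν q.swap))
      hd₂ fun q hq => νd₂ q.swap hq

/-- The Dirac mass at `(a, b)` is a witness at distance zero from its marginals. -/
theorem Lifting.pure {α β : Type} (ε δ : ENNReal) {Ψ : Set (α × β)} {a : α} {b : β}
    (h : (a, b) ∈ Ψ) : Lifting ε δ Ψ (PMF.pure a) (PMF.pure b) := by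
  classical
  have h₁ : marginalFst (PMF.pure (a, b)) = PMF.pure a := by
    funext x
    by_cases hx : x = a <;> simp [marginalFst, PMF.pure_apply, hx, Prod.ext_iff]
  have h₂ : marginalSnd (PMF.pure (a, b)) = PMF.pure b := by
    funext x
    by_cases hx : x = b <;> simp [marginalSnd, PMF.pure_apply, hx, Prod.ext_iff]
  refine ⟨PMF.pure (a, b), (PMF.tsum_coe _).le, fun q hq => ?_, ⟨?_, ?_⟩, ?_, ?_⟩
  · have : q = (a, b) := by
      by_contra hne
      simp [PMF.pure_apply, hne] at hq
    exact this ▸ h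
  · exact fun x => (congrFun h₁ x).le
  · exact fun x => (congrFun h₂ x).le
  · rw [h₁, epsDist_self]; exact zero_le
  · rw [h₂, epsDist_self]; exact zero_le

theorem Lifting.mono {α β : Type} {ε₁ ε₂ δ₁ δ₂ : ENNReal} {Ψ Φ : Set (α × β)} {p₁ : PMF α}
    {p₂ : PMF β} (hε : ε₁ ≤ ε₂) (hδ : δ₁ ≤ δ₂) (hΨ : Ψ ⊆ Φ) (h : Lifting ε₁ δ₁ Ψ p₁ p₂) :
    Lifting ε₂ δ₂ Φ p₁ p₂ := by
  obtain ⟨μ, hmass, hsupp, hle, hd₁, hd₂⟩ := h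
  exact ⟨μ, hmass, fun q hq => hΨ (hsupp q hq), hle,
    (epsDist_anti hε _ _).trans (hd₁.trans hδ), (epsDist_anti hε _ _).trans (hd₂.trans hδ)⟩

/-! ### Environments and subtyping -/

theorem Env.ren_leftVar_cons {Δ : List Ty} {τ : Ty} (d₁ d₂ : τ.den) (θ : Env (dbl Δ)) :
    Env.ren (Γ := τ :: Δ) leftVar ((θ.cons d₂).cons d₁) = (θ.ren leftVar).cons d₁ := by
  funext σ x; cases x <;> rfl

theorem Env.ren_rightVar_cons {Δ : List Ty} {τ : Ty} (d₁ d₂ : τ.den) (θ : Env (dbl Δ)) :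
    Env.ren (Γ := τ :: Δ) rightVar ((θ.cons d₂).cons d₁) = (θ.ren rightVar).cons d₂ := by
  funext σ x; cases x <;> rfl

theorem Tm.den_left {Δ : List Ty} {τ : Ty} (e : Tm Δ τ) (θ : Env (dbl Δ)) :
    e.left.den θ = e.den (θ.ren leftVar) := e.den_ren _ _

theorem Tm.den_right {Δ : List Ty} {τ : Ty} (e : Tm Δ τ) (θ : Env (dbl Δ)) :
    e.right.den θ = e.den (θ.ren rightVar) := e.den_ren _ _

theorem REnv.Valid.bind_core {Δ : List Ty} {G : REnv Δ} {θ : Env (dbl Δ)} (h : G.Valid θ)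
    {c : CoreTy} (d₁ d₂ : c.den) :
    (G.bind (.core c)).Valid (Env.cons (σ := .core c) d₁ (Env.cons (σ := .core c) d₂ θ)) :=
  ⟨h, by rw [RTy.den]; trivial⟩

theorem REnv.lookup_sound {Δ : List Ty} (G : REnv Δ) {τ : Ty} (x : Var Δ τ)
    (θ : Env (dbl Δ)) (h : G.Valid θ) :
    (θ _ (leftVar _ x), θ _ (rightVar _ x)) ∈ (G.lookup x).den θ := by
  induction G with
  | nil => cases x
  | bind G T ih =>
    cases x with
    | z =>
      rw [REnv.lookup, RTy.den_ren]
      exact h.2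
    | s x =>
      rw [REnv.lookup, RTy.den_ren]
      exact ih x θ.tail.tail h.1
  | hyp G φ ih =>
    rw [REnv.lookup]
    exact ih x θ h.1

theorem Subty.sound {Δ : List Ty} {τ : Ty} {G : REnv Δ} {T U : RTy (dbl Δ) τ}
    (h : Subty G T U) (θ : Env (dbl Δ)) (hθ : G.Valid θ) : T.den θ ⊆ U.den θ := by
  induction h with
  | refl G T => exact subset_rfl
  | trans _ _ ih₁ ih₂ => exact (ih₁ θ hθ).trans (ih₂ θ hθ)
  | list _ _ => exact subset_rfl
  | part _ ih =>
    simp only [RTy.den]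
    rintro p (hp | ⟨d₁, d₂, h₁, h₂, hd⟩)
    · exact Or.inl hp
    · exact Or.inr ⟨d₁, d₂, h₁, h₂, ih θ hθ hd⟩
  | left G T φ =>
    simp only [RTy.den]
    exact fun p hp => hp.1
  | right φ _ hφ ih =>
    rw [RTy.den]
    exact fun p hp => ⟨ih θ hθ hp, hφ ((θ.cons p.2).cons p.1) ⟨hθ, hp⟩⟩
  | prob _ hle ih =>
    simp only [RTy.den]
    exact fun p hp => Lifting.mono (hle θ hθ).1.1 (hle θ hθ).2.1 (ih θ hθ) hp
  | pi _ _ ih₁ ih₂ =>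
    simp only [RTy.den]
    exact fun f hf d₁ d₂ hd => ih₂ ((θ.cons d₂).cons d₁) ⟨hθ, hd⟩ (hf d₁ d₂ (ih₁ θ hθ hd))

/-! ### Related recursive functions -/

/-- Two unions of iterates are related at related arguments, without any monotonicity. All iterates
are related, starting from `(⊥, ⊥)`, so both sides become defined at the same stage, the one at
which both values are taken. -/
theorem kleene_related {α β : Type} {F₁ F₂ : (α → Part β) → α → Part β} {R : Set (α × α)}
    {S : α → α → Set (β × β)}
    (hF : ∀ d₁ d₂ : α → Part β,
      (∀ a₁ a₂, (a₁, a₂) ∈ R → (d₁ a₁ = Part.none ∧ d₂ a₂ = Part.none) ∨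
        ∃ b₁ b₂, d₁ a₁ = Part.some b₁ ∧ d₂ a₂ = Part.some b₂ ∧ (b₁, b₂) ∈ S a₁ a₂) →
      ∀ a₁ a₂, (a₁, a₂) ∈ R → (F₁ d₁ a₁ = Part.none ∧ F₂ d₂ a₂ = Part.none) ∨
        ∃ b₁ b₂, F₁ d₁ a₁ = Part.some b₁ ∧ F₂ d₂ a₂ = Part.some b₂ ∧ (b₁, b₂) ∈ S a₁ a₂)
    {a₁ a₂ : α} (ha : (a₁, a₂) ∈ R) :
    (kleene F₁ a₁ = Part.none ∧ kleene F₂ a₂ = Part.none) ∨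
      ∃ b₁ b₂, kleene F₁ a₁ = Part.some b₁ ∧ kleene F₂ a₂ = Part.some b₂ ∧
        (b₁, b₂) ∈ S a₁ a₂ := by
  classical
  have hiter : ∀ n a₁ a₂, (a₁, a₂) ∈ R →
      ((F₁^[n] ⊥) a₁ = Part.none ∧ (F₂^[n] ⊥) a₂ = Part.none) ∨
        ∃ b₁ b₂, (F₁^[n] ⊥) a₁ = Part.some b₁ ∧ (F₂^[n] ⊥) a₂ = Part.some b₂ ∧
          (b₁, b₂) ∈ S a₁ a₂ := by
    intro n
    induction n with
    | zero => exact fun _ _ _ => Or.inl ⟨rfl, rfl⟩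
    | succ n ih =>
      rw [Function.iterate_succ_apply', Function.iterate_succ_apply']
      exact hF _ _ ih
  have hdom : ∀ n, ((F₁^[n] ⊥) a₁).Dom ↔ ((F₂^[n] ⊥) a₂).Dom := by
    intro n
    rcases hiter n a₁ a₂ ha with ⟨h₁, h₂⟩ | ⟨b₁, b₂, h₁, h₂, -⟩ <;> rw [h₁, h₂]
    exact Iff.rfl
  by_cases h : ∃ n, ((F₁^[n] ⊥) a₁).Dom
  · have h' : ∃ n, ((F₂^[n] ⊥) a₂).Dom := h.imp fun n => (hdom n).1
    have hfind : Nat.find h' = Nat.find h := Nat.find_congr' fun {n} => (hdom n).symm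
    rw [kleene, kleene, dif_pos h, dif_pos h', hfind]
    exact hiter _ a₁ a₂ ha
  · have h' : ¬ ∃ n, ((F₂^[n] ⊥) a₂).Dom := fun hn => h (hn.imp fun n => (hdom n).2)
    rw [kleene, kleene, dif_neg h, dif_neg h']
    exact Or.inl ⟨rfl, rfl⟩

/-- Two terminating recursions are related at related arguments: start the iteration at some related
pair, which exists by the guard, and wait until the iterates are stable on both sides. -/
theorem kleeneSN_related {α β : Type} (b₀ : β) {F₁ F₂ : (α → β) → α → β} {R : Set (α × α)}
    {S : α → α → Set (β × β)} (h₁ : Terminating F₁) (h₂ : Terminating F₂)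
    (hne : ∃ d₁ d₂ : α → β, ∀ a₁ a₂, (a₁, a₂) ∈ R → (d₁ a₁, d₂ a₂) ∈ S a₁ a₂)
    (hF : ∀ d₁ d₂ : α → β, (∀ a₁ a₂, (a₁, a₂) ∈ R → (d₁ a₁, d₂ a₂) ∈ S a₁ a₂) →
      ∀ a₁ a₂, (a₁, a₂) ∈ R → (F₁ d₁ a₁, F₂ d₂ a₂) ∈ S a₁ a₂)
    {a₁ a₂ : α} (ha : (a₁, a₂) ∈ R) : (kleeneSN b₀ F₁ a₁, kleeneSN b₀ F₂ a₂) ∈ S a₁ a₂ := by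
  obtain ⟨r₁, hr₁⟩ := h₁
  obtain ⟨r₂, hr₂⟩ := h₂
  obtain ⟨d₁, d₂, hd⟩ := hne
  have hiter : ∀ n a₁ a₂, (a₁, a₂) ∈ R → ((F₁^[n] d₁) a₁, (F₂^[n] d₂) a₂) ∈ S a₁ a₂ := by
    intro n
    induction n with
    | zero => exact hd
    | succ n ih =>
      rw [Function.iterate_succ_apply', Function.iterate_succ_apply']
      exact hF _ _ ih
  -- Beyond both sizes, the iterates have reached the recursive functions.
  rw [kleeneSN_eq b₀ hr₁ (r₁ a₁ + r₂ a₂ + 1) a₁ (by omega) d₁,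
    kleeneSN_eq b₀ hr₂ (r₁ a₁ + r₂ a₂ + 1) a₂ (by omega) d₂]
  exact hiter _ _ _ ha

/-! ### Soundness of typing -/

theorem Tm.den_ite {Γ : List Ty} {τ : Ty} (e : Tm Γ (.core .bool)) (e₁ e₂ : Tm Γ τ) (θ : Env Γ) :
    (e.den θ = true ∧ (Tm.ite e e₁ e₂).den θ = e₁.den θ) ∨
      (e.den θ = false ∧ (Tm.ite e e₁ e₂).den θ = e₂.den θ) := by
  rw [Tm.den]
  rcases Bool.eq_false_or_eq_true (e.den θ) with h | h <;> simp [h]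

theorem Tm.den_case {Γ : List Ty} {c : CoreTy} {τ : Ty} (e : Tm Γ (.core (.list c)))
    (e₁ : Tm Γ τ) (e₂ : Tm (.core (.list c) :: .core c :: Γ) τ) (θ : Env Γ) :
    (e.den θ = [] ∧ (Tm.case e e₁ e₂).den θ = e₁.den θ) ∨
      ∃ v vs, e.den θ = v :: vs ∧
        (Tm.case e e₁ e₂).den θ = e₂.den (Env.cons (σ := .core (.list c)) vs
          (Env.cons (σ := .core c) v θ)) := by
  rw [Tm.den]
  rcases h : e.den θ with _ | ⟨v, vs⟩
  · exact Or.inl ⟨rfl, rfl⟩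
  · exact Or.inr ⟨v, vs, rfl, rfl⟩

/-- Soundness, with the left and right instances of the variables selected in the valuation and not
in the expressions. -/
theorem Typed.sound {Δ : List Ty} {τ : Ty} {G : REnv Δ} {e₁ e₂ : Tm Δ τ} {T : RTy (dbl Δ) τ}
    (h : Typed G e₁ e₂ T) (θ : Env (dbl Δ)) (hθ : G.Valid θ) :
    (e₁.den (θ.ren leftVar), e₂.den (θ.ren rightVar)) ∈ T.den θ := by
  induction h with
  | var G x => exact G.lookup_sound x θ hθ
  | abs _ ih =>
    rw [RTy.den]
    intro d₁ d₂ hd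
    have := ih ((θ.cons d₂).cons d₁) ⟨hθ, hd⟩
    rwa [Env.ren_leftVar_cons, Env.ren_rightVar_cons] at this
  | app _ _ ih₁ ih₂ =>
    rw [RTy.den_subst, Env.subst_two, Tm.den_left, Tm.den_right]
    have := ih₁ θ hθ
    rw [RTy.den] at this
    exact this _ _ (ih₂ θ hθ)
  | letin _ _ ih₁ ih₂ =>
    rw [RTy.den_subst, Env.subst_two, Tm.den_left, Tm.den_right]
    have := ih₂ ((θ.cons _).cons _) ⟨hθ, ih₁ θ hθ⟩
    rwa [Env.ren_leftVar_cons, Env.ren_rightVar_cons] at this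
  | @letrecSN Δ τ σ G T U e e' _ hg ih =>
    obtain ⟨t₁, t₂, ⟨d₁, d₂⟩, hd⟩ := hg θ hθ
    rw [RTy.den] at hd ⊢
    intro a₁ a₂ ha
    -- The guard speaks of the renamed bodies, the denotation of renamed valuations.
    have hF : ∀ {Γ'} (e : Tm (τ :: .fn τ σ :: Δ) σ) (ρ : Ren Δ Γ') (θ : Env Γ'),
        (e.ren ρ.lift.lift).functional θ = e.functional (θ.ren ρ) := fun e ρ θ => by
      funext d v
      simp only [Tm.functional, Tm.den_ren, Env.ren_lift]
    rw [hF] at t₁ t₂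
    refine kleeneSN_related σ.default (R := T.den θ)
      (S := fun a₁ a₂ => U.den ((θ.cons a₂).cons a₁)) t₁ t₂ ⟨d₁, d₂, hd⟩ ?_ ha
    intro d₁ d₂ hd
    have := ih (Env.cons (σ := .fn τ σ) d₁ (Env.cons (σ := .fn τ σ) d₂ θ))
      ⟨hθ, by rw [RTy.den]; exact hd⟩
    rw [Env.ren_leftVar_cons, Env.ren_rightVar_cons, RTy.den_ren] at this
    exact this
  | @letrec Δ τ σ G T U e e' _ ih =>
    rw [RTy.den]
    intro a₁ a₂ ha
    rw [RTy.den]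
    refine kleene_related (R := T.den θ)
      (S := fun a₁ a₂ => U.den ((θ.cons a₂).cons a₁)) ?_ ha
    intro d₁ d₂ hd
    have := ih (Env.cons (σ := .fn τ (.part σ)) d₁ (Env.cons (σ := .fn τ (.part σ)) d₂ θ))
      ⟨hθ, by simp only [RTy.den]; exact hd⟩
    rw [Env.ren_leftVar_cons, Env.ren_rightVar_cons, RTy.den_ren] at this
    simp only [RTy.den] at this
    exact this
  | @ite Δ τ G T e e' e₁ e₁' e₂ e₂' _ hiff _ _ _ ih₁ ih₂ =>
    have hiff := hiff θ hθ
    rw [Tm.den_left, Tm.den_right] at hiff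
    rcases Tm.den_ite e e₁ e₂ (θ.ren leftVar) with ⟨h₁, h₁'⟩ | ⟨h₁, h₁'⟩ <;>
      rcases Tm.den_ite e' e₁' e₂' (θ.ren rightVar) with ⟨h₂, h₂'⟩ | ⟨h₂, h₂'⟩ <;>
      rw [h₁, h₂] at hiff <;> rw [h₁', h₂']
    · refine ih₁ θ ⟨hθ, ?_⟩
      simp only [Assn.den, Tm.den_left, Tm.den_right]
      exact ⟨h₁, h₂⟩
    · simp at hiff
    · simp at hiff
    · refine ih₂ θ ⟨hθ, ?_⟩
      simp only [Assn.den, Tm.den_left, Tm.den_right]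
      exact ⟨h₁, h₂⟩
  | @case Δ c τ G T e e' e₁ e₁' e₂ e₂' _ hiff _ _ _ ih₁ ih₂ =>
    have hiff := hiff θ hθ
    rw [Tm.den_left, Tm.den_right] at hiff
    rcases Tm.den_case e e₁ e₂ (θ.ren leftVar) with ⟨h₁, h₁'⟩ | ⟨v₁, vs₁, h₁, h₁'⟩ <;>
      rcases Tm.den_case e' e₁' e₂' (θ.ren rightVar) with ⟨h₂, h₂'⟩ | ⟨v₂, vs₂, h₂, h₂'⟩ <;>
      rw [h₁, h₂] at hiff <;> rw [h₁', h₂']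
    · exact ih₁ θ hθ
    · simp at hiff
    · simp at hiff
    · have := ih₂ (Env.cons (σ := .core (.list c)) vs₁ (Env.cons (σ := .core (.list c)) vs₂
        (Env.cons (σ := .core c) v₁ (Env.cons (σ := .core c) v₂ θ))))
        ⟨(hθ.bind_core _ _).bind_core _ _, by
          simp only [Assn.den, Tm.den_ren]
          exact ⟨(Tm.den_left _ _).trans h₁, (Tm.den_right _ _).trans h₂⟩⟩
      rw [RTy.den_ren] at this
      simp only [Env.ren_leftVar_cons, Env.ren_rightVar_cons] at this
      exact this
  | unitC _ ih =>
    rw [RTy.den]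
    exact Or.inr ⟨_, _, rfl, rfl, ih θ hθ⟩
  | @bindC Δ τ σ G T₁ T₂ e₁ e₁' e₂ e₂' _ _ ih₁ ih₂ =>
    have h₁ := ih₁ θ hθ
    rw [RTy.den] at h₁
    rcases h₁ with ⟨h, h'⟩ | ⟨d₁, d₂, h, h', hd⟩
    · simp only at h h'
      rw [RTy.den]
      refine Or.inl ⟨?_, ?_⟩
      · simp only [Tm.den, h, Part.bind_none]
      · simp only [Tm.den, h', Part.bind_none]
    · simp only at h h'
      have := ih₂ ((θ.cons d₂).cons d₁) ⟨hθ, hd⟩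
      rw [Env.ren_leftVar_cons, Env.ren_rightVar_cons, RTy.den_ren] at this
      rw [Tm.den, Tm.den, h, h', Part.bind_some, Part.bind_some]
      exact this
  | unitM ε δ _ ih =>
    rw [RTy.den]
    exact Lifting.pure _ _ (ih θ hθ)
  | bindM _ _ ih₁ ih₂ =>
    have h₁ := ih₁ θ hθ
    rw [RTy.den] at h₁ ⊢
    refine Lifting.bind h₁ fun d₁ d₂ hd => ?_
    have := ih₂ ((θ.cons d₂).cons d₁) ⟨hθ, hd⟩
    rw [Env.ren_leftVar_cons, Env.ren_rightVar_cons, RTy.den_ren, RTy.den] at this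
    exact this
  | sub _ hs ih => exact hs.sound θ hθ (ih θ hθ)
  | redLeft hr _ ih => exact hr.den_eq (θ.ren leftVar) ▸ ih θ hθ
  | redRight hr _ ih => exact hr.den_eq (θ.ren rightVar) ▸ ih θ hθ
  | @iteLeft Δ τ G T e e₁ e₂ e' _ _ ih₁ ih₂ =>
    rcases Tm.den_ite e e₁ e₂ (θ.ren leftVar) with ⟨h, h'⟩ | ⟨h, h'⟩ <;> rw [h']
    · refine ih₁ θ ⟨hθ, ?_⟩
      rw [Assn.den, Tm.den_left]
      exact h
    · refine ih₂ θ ⟨hθ, ?_⟩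
      rw [Assn.den, Tm.den_left]
      exact h
  | @iteRight Δ τ G T e e₁ e₂ e' _ _ ih₁ ih₂ =>
    rcases Tm.den_ite e e₁ e₂ (θ.ren rightVar) with ⟨h, h'⟩ | ⟨h, h'⟩ <;> rw [h']
    · refine ih₁ θ ⟨hθ, ?_⟩
      rw [Assn.den, Tm.den_right]
      exact h
    · refine ih₂ θ ⟨hθ, ?_⟩
      rw [Assn.den, Tm.den_right]
      exact h
  | @caseLeft Δ c τ G T e e₁ e' e₂ _ _ ih₁ ih₂ =>
    rcases Tm.den_case e e₁ e₂ (θ.ren leftVar) with ⟨h, h'⟩ | ⟨v, vs, h, h'⟩ <;> rw [h']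
    · refine ih₁ θ ⟨hθ, ?_⟩
      rw [Assn.den, Tm.den_left]
      exact h
    · -- The other instances of the two variables are unconstrained; the same values serve.
      have := ih₂ (Env.cons (σ := .core (.list c)) vs (Env.cons (σ := .core (.list c)) vs
        (Env.cons (σ := .core c) v (Env.cons (σ := .core c) v θ))))
        ⟨(hθ.bind_core _ _).bind_core _ _, by
          simp only [Assn.den, Tm.den_ren]
          exact (Tm.den_left _ _).trans h⟩
      rw [RTy.den_ren, Tm.den_ren] at this
      simp only [Env.ren_leftVar_cons, Env.ren_rightVar_cons] at this
      exact this
  | @caseRight Δ c τ G T e e₁ e' e₂ _ _ ih₁ ih₂ =>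
    rcases Tm.den_case e e₁ e₂ (θ.ren rightVar) with ⟨h, h'⟩ | ⟨v, vs, h, h'⟩ <;> rw [h']
    · refine ih₁ θ ⟨hθ, ?_⟩
      rw [Assn.den, Tm.den_right]
      exact h
    · -- The other instances of the two variables are unconstrained; the same values serve.
      have := ih₂ (Env.cons (σ := .core (.list c)) vs (Env.cons (σ := .core (.list c)) vs
        (Env.cons (σ := .core c) v (Env.cons (σ := .core c) v θ))))
        ⟨(hθ.bind_core _ _).bind_core _ _, by
          simp only [Assn.den, Tm.den_ren]
          exact (Tm.den_right _ _).trans h⟩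
      rw [RTy.den_ren, Tm.den_ren] at this
      simp only [Env.ren_leftVar_cons, Env.ren_rightVar_cons] at this
      exact this
  | _ =>
    -- The remaining rules have a core type, which denotes the full relation.
    rw [RTy.den]
    trivial

end HOARe

theorem theorem3p1 {Δ : List HOARe.Ty} {τ : HOARe.Ty} (G : HOARe.REnv Δ)
    (e₁ e₂ : HOARe.Tm Δ τ) (T : HOARe.RTy (HOARe.dbl Δ) τ) (h : HOARe.Typed G e₁ e₂ T)
    (θ : HOARe.Env (HOARe.dbl Δ)) (hθ : G.Valid θ) :
    (e₁.left.den θ, e₂.right.den θ) ∈ T.den θ := by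
  rw [HOARe.Tm.den_left, HOARe.Tm.den_right]
  exact h.sound θ hθ
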